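/- Let $q$ be an indeterminate and work over the field $\mathbb{C}(q)$. For an integer $N\ge 0$ let $\mathcal{O}_q(\mathrm{Mat}_N)$ be the unital associative $\mathbb{C}(q)$-algebra with generators $t_{ij}$ ($1\le i,j\le N$) and defining relations $$t_{ki}t_{kj}=q\,t_{kj}t_{ki},\qquad t_{ik}t_{jk}=q\,t_{jk}t_{ik}\qquad (i<j),$$ $$t_{il}t_{kj}=t_{kj}t_{il},\qquad t_{ij}t_{kl}-t_{kl}t_{ij}=(q-q^{-1})\,t_{kj}t_{il}\qquad (i<k,\ j<l).$$ Let $n\ge 0$ be an integer. Consider the following three families, each given by an algebra $\mathscr{P}$, a square matrix $T=(t_{ij})$ over $\mathscr{P}$ and a matrix $J$ over $\mathbb{C}(q)$ of the same size. * Type AI: $\mathscr{P}=\mathcal{O}_q(\mathrm{Mat}_n)$, $T$ is the $n\times n$ matrix of generators, $J=I_n$. * Type AII: $\mathscr{P}=\mathcal{O}_q(\mathrm{Mat}_{2n})$, $T$ is the $2n\times 2n$ matrix of generators, $J=\sum_{k=1}^n(e_{2k-1,2k}-q\,e_{2k,2k-1})$. * Diagonal type: $\mathscr{P}=\mathcal{O}_q(\mathrm{Mat}_n)\otimes_{\mathbb{C}(q)}\mathcal{O}_q(\mathrm{Mat}_n)$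 with componentwise multiplication, $T$ is the $2n\times 2n$ matrix for which $t_{ij}$ and $t_{n+i,n+j}$ ($1\le i,j\le n$) are the generators of the first and of the second tensor factor and $t_{i,n+j}=t_{n+i,j}=0$, and $J=\sum_{k=1}^n(e_{k,n+k}+e_{n+k,k})$. In each case set $x_{ij}=\sum_{r,s}t_{ir}J_{r,s}t_{js}$, i.e. $X=(x_{ij})=TJT^{t}$, and let $\mathscr{P}_\theta$ be the unital subalgebra of $\mathscr{P}$ generated by all the $x_{ij}$. Then the following monomials, with each exponent $m_{ij}$ running over the nonnegative integers, form a $\mathbb{C}(q)$-basis of $\mathscr{P}_\theta$ (distinct exponent tuples giving distinct basis elements): 1. Type AI: the products $\prod_{1\le i\le j\le n}x_{ij}^{m_{ij}}$, 2. Type AII: the products $\prod_{1\le i<j\le 2n}x_{ij}^{m_{ij}}$, 3. Diagonal type: the products $\prod_{1\le i,j\le n}x_{i,n+j}^{m_{ij}}$, where in each product the factors are multiplied from left to right in increasing lexicographic order of $(i,j)$. Moreover, in each of the three cases, the monomials obtained by multiplying the same factors in the reversed order also form a basis of $\mathscr{P}_\theta$. -/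

import Mathlib

namespace QuantumHomogeneous

/-- The base field `ℂ(q)` of rational functions in one indeterminate. -/
abbrev Kq : Type := RatFunc ℂ

/-- The indeterminate `q`. -/
noncomputable def q : Kq := RatFunc.X

/-- The defining relations of `𝒪_q(Mat_N)`, imposed on the free algebra on letters `t_{ij}`. -/
inductive QMatRel (N : ℕ) :
    FreeAlgebra Kq (Fin N × Fin N) → FreeAlgebra Kq (Fin N × Fin N) → Prop
  | row (k i j : Fin N) (hij : i < j) :
      QMatRel N (FreeAlgebra.ι Kq (k, i) * FreeAlgebra.ι Kq (k, j))
        (q • (FreeAlgebra.ι Kq (k, j) * FreeAlgebra.ι Kq (k, i)))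
  | col (k i j : Fin N) (hij : i < j) :
      QMatRel N (FreeAlgebra.ι Kq (i, k) * FreeAlgebra.ι Kq (j, k))
        (q • (FreeAlgebra.ι Kq (j, k) * FreeAlgebra.ι Kq (i, k)))
  | anti (i k j l : Fin N) (hik : i < k) (hjl : j < l) :
      QMatRel N (FreeAlgebra.ι Kq (i, l) * FreeAlgebra.ι Kq (k, j))
        (FreeAlgebra.ι Kq (k, j) * FreeAlgebra.ι Kq (i, l))
  | diag (i k j l : Fin N) (hik : i < k) (hjl : j < l) :
      QMatRel N
        (FreeAlgebra.ι Kq (i, j) * FreeAlgebra.ι Kq (k, l)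
          - FreeAlgebra.ι Kq (k, l) * FreeAlgebra.ι Kq (i, j))
        ((q - q⁻¹) • (FreeAlgebra.ι Kq (k, j) * FreeAlgebra.ι Kq (i, l)))

/-- The quantized function algebra `𝒪_q(Mat_N)`. -/
abbrev QMat (N : ℕ) : Type := RingQuot (QMatRel N)

/-- The generator matrix `T = (t_{ij})` of `𝒪_q(Mat_N)`. -/
noncomputable def genT (N : ℕ) : Matrix (Fin N) (Fin N) (QMat N) :=
  Matrix.of fun i j => RingQuot.mkAlgHom Kq (QMatRel N) (FreeAlgebra.ι Kq (i, j))

/-- The matrix `X = T J Tᵗ`, with entries `x_{ij} = ∑_{r,s} t_{ir} J_{rs} t_{js}`. -/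
noncomputable def matX {ι A : Type} [Fintype ι] [Ring A] [Algebra Kq A]
    (T : Matrix ι ι A) (J : Matrix ι ι Kq) : Matrix ι ι A :=
  T * J.map (algebraMap Kq A) * T.transpose

/-- The subalgebra generated by all entries of a matrix. -/
noncomputable def entryAlgebra {ι A : Type} [Ring A] [Algebra Kq A]
    (X : Matrix ι ι A) : Subalgebra Kq A :=
  Algebra.adjoin Kq (Set.range fun p : ι × ι => X p.1 p.2)

/-- Type AI: `J = I_n`, inside `𝒪_q(Mat_n)`. -/
noncomputable def xAI (n : ℕ) : Matrix (Fin n) (Fin n) (QMat n) :=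
  matX (genT n) 1

/-- Type AII: `J = ∑_k (e_{2k-1,2k} - q e_{2k,2k-1})` of size `2n` (here with indices from `0`). -/
noncomputable def jAII (n : ℕ) : Matrix (Fin (2 * n)) (Fin (2 * n)) Kq :=
  ∑ k : Fin n,
    (Matrix.single (⟨2 * k, by omega⟩ : Fin (2 * n)) (⟨2 * k + 1, by omega⟩ : Fin (2 * n)) (1 : Kq)
      - q • Matrix.single (⟨2 * k + 1, by omega⟩ : Fin (2 * n))
          (⟨2 * k, by omega⟩ : Fin (2 * n)) (1 : Kq))

noncomputable def xAII (n : ℕ) : Matrix (Fin (2 * n)) (Fin (2 * n)) (QMat (2 * n)) :=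
  matX (genT (2 * n)) (jAII n)

/-- Diagonal type: `𝒫 = 𝒪_q(Mat_n) ⊗ 𝒪_q(Mat_n)`. -/
abbrev PDiag (n : ℕ) : Type := TensorProduct Kq (QMat n) (QMat n)

/-- Diagonal type: the block diagonal matrix whose blocks are the generators of the two tensor
factors. The index `Sum.inl i` stands for `i`, and `Sum.inr i` for `n + i`. -/
noncomputable def tDiag (n : ℕ) : Matrix (Fin n ⊕ Fin n) (Fin n ⊕ Fin n) (PDiag n) :=
  Matrix.fromBlocks
    ((genT n).map (Algebra.TensorProduct.includeLeft : QMat n →ₐ[Kq] PDiag n)) 0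
    0 ((genT n).map (Algebra.TensorProduct.includeRight : QMat n →ₐ[Kq] PDiag n))

/-- Diagonal type: `J = ∑_k (e_{k,n+k} + e_{n+k,k})`. -/
noncomputable def xDiag (n : ℕ) : Matrix (Fin n ⊕ Fin n) (Fin n ⊕ Fin n) (PDiag n) :=
  matX (tDiag n) (Matrix.fromBlocks 0 1 1 0)

/-- Index pairs `(i, j)` with `i ≤ j`, in lexicographic order. -/
abbrev PairsLE (N : ℕ) : Type := {p : Fin N ×ₗ Fin N // (ofLex p).1 ≤ (ofLex p).2}

/-- Index pairs `(i, j)` with `i < j`, in lexicographic order. -/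
abbrev PairsLT (N : ℕ) : Type := {p : Fin N ×ₗ Fin N // (ofLex p).1 < (ofLex p).2}

/-- The monomial `∏ x_s ^ {m_s}`, factors multiplied with `s` increasing from left to right. -/
noncomputable def monomialAsc {σ A : Type} [Fintype σ] [LinearOrder σ] [Monoid A]
    (x : σ → A) (m : σ → ℕ) : A :=
  ((Finset.univ.sort (α := σ) (· ≤ ·)).map fun s => x s ^ m s).prod

/-- The same monomial with its factors multiplied in the reversed order. -/
noncomputable def monomialDesc {σ A : Type} [Fintype σ] [LinearOrder σ] [Monoid A]
    (x : σ → A) (m : σ → ℕ) : A :=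
  ((Finset.univ.sort (α := σ) (· ≤ ·)).reverse.map fun s => x s ^ m s).prod

/-- The family `v` of elements of `A` is a `ℂ(q)`-basis of the subalgebra `P`. -/
def IsBasisOf {κ A : Type} [Ring A] [Algebra Kq A] (P : Subalgebra Kq A) (v : κ → A) : Prop :=
  ∃ b : Module.Basis κ Kq P, ∀ m, (b m : A) = v m

end QuantumHomogeneous

/-!
The algebras are deformations, with parameter `q`, of commutative polynomial rings at `q = 1`, and
both halves of the basis property are read off at `q = 1`. Let `A` be the valuation ring of `ℂ(q)`
at `q = 1`, with maximal ideal `𝔪` (`exists_valuationRing`).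

*Spanning.* Let `V` be the `A`-span of the generators. If all their commutators lie in `𝔪 V²`, then
reordering a word of length `d` changes it by an element of `𝔪 Vᵈ` only, so by Nakayama's lemma the
ordered words of length `d` span the finitely generated module `Vᵈ`, for any fixed order of the
generators (`adjoin_le_span_orderedMonomial`). For the entries of `X = T J Tᵗ` the commutators are
controlled by the reflection equation `R X₁ R' X₂ = X₂ R' X₁ R`, where `R'` is the partial transpose
of the R-matrix `R`: `X` inherits it from `J` (`IsQuantumMatrix.reflection`), and both `R` and `R'`
reduce to the identity modulo `𝔪` (`commutator_mem_of_reflection`). In type AI the lower triangular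
entries of `X`, and in type AII also the diagonal ones, are multiples of the listed generators by
direct computation. In the diagonal type the nonzero blocks of `X` are `Y = T⁽¹⁾ (T⁽²⁾)ᵗ` and its
transpose, and `Y` is itself a quantum matrix because the two factors commute.

*Independence.* A linear relation among ordered monomials can be rescaled to have coefficients in
`A`, one of them equal to `1`. Given a homomorphism from the quantum algebra to `ℂ(q) ⊗ B`, for a
flat `A`-algebra `B` with a homomorphism `π : B → C` to a commutative algebra over the residue
field, which sends the generators to elements `y` of `B`, such a relation yields an algebraic
relation among the `π y` (`linearIndependent_orderedMonomial`). It remains to find `B` and `π` for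
which the `π y` are algebraically independent. Call a matrix a classical limit if it is the image
under some such `π` of a quantum matrix over `B`. Classical limits are closed under products, by the
coproduct, and under transposition. Diagonal matrices are classical limits, and so are the
elementary matrices at adjacent positions, through an action of `q`-commuting operators on
polynomials. Hence every matrix over a field is a classical limit (`isClassicalLimit`), in
particular a triangular matrix `M` with independent coordinates. The entries of `M J Mᵗ` are then
algebraically independent, since a Cholesky decomposition recovers the coordinates of `M` from them
up to square roots (`algebraicIndependent_lowerMatrix`, `algebraicIndependent_blockLowerMatrix`). In
the diagonal type the counit of the second factor maps `Y` to the generic quantum matrix.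
-/

namespace QuantumHomogeneous

open IsLocalRing

/-! ### Ordered monomials and flat deformations of polynomial rings -/

section Spanning

variable {A P σ : Type*} [CommRing A] [Ring P] [Algebra A P]

/-- The monomial with exponents `m` in the family `x`, its factors multiplied in the order in which
the list `l` enumerates the index set. -/
def orderedMonomial {M : Type*} [Monoid M] (l : List σ) (x : σ → M) (m : σ → ℕ) : M :=
  (l.map fun s => x s ^ m s).prod

lemma mul_mem_smul_mul {I : Ideal A} {V W : Submodule A P} {a b : P} (ha : a ∈ V)
    (hb : b ∈ I • W) : a * b ∈ I • (V * W) := by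
  refine Submodule.smul_induction_on hb (fun r hr n hn => ?_) (fun x y hx hy => ?_)
  · rw [mul_smul_comm]
    exact Submodule.smul_mem_smul hr (Submodule.mul_mem_mul ha hn)
  · rw [mul_add]
    exact add_mem hx hy

lemma smul_mul_mem_smul_mul {I : Ideal A} {V W : Submodule A P} {a b : P} (ha : a ∈ I • V)
    (hb : b ∈ W) : a * b ∈ I • (V * W) := by
  refine Submodule.smul_induction_on ha (fun r hr n hn => ?_) (fun x y hx hy => ?_)
  · rw [smul_mul_assoc]
    exact Submodule.smul_mem_smul hr (Submodule.mul_mem_mul hn hb)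
  · rw [add_mul]
    exact add_mem hx hy

lemma prod_map_mem_span_pow (x : σ → P) (w : List σ) :
    (w.map x).prod ∈ Submodule.span A (Set.range x) ^ w.length := by
  induction w with
  | nil => exact Submodule.one_le.1 (by simp)
  | cons s w ih =>
    rw [List.map_cons, List.prod_cons, List.length_cons, pow_succ']
    exact Submodule.mul_mem_mul (Submodule.subset_span ⟨s, rfl⟩) ih

/-- If the generators commute modulo `I`, then rearranging a word changes it only modulo `I`. -/
lemma prod_sub_prod_mem_of_perm {x : σ → P} {I : Ideal A}
    (hx : ∀ s t, x s * x t - x t * x s ∈ I • Submodule.span A (Set.range x) ^ 2)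
    {w w' : List σ} (h : w.Perm w') :
    (w.map x).prod - (w'.map x).prod ∈ I • Submodule.span A (Set.range x) ^ w.length := by
  induction h with
  | nil => simp
  | cons s h ih =>
    rw [List.map_cons, List.prod_cons, List.map_cons, List.prod_cons, ← mul_sub,
      List.length_cons, pow_succ']
    exact mul_mem_smul_mul (Submodule.subset_span ⟨s, rfl⟩) ih
  | swap s t w =>
    simp only [List.map_cons, List.prod_cons, List.length_cons, ← mul_assoc, ← sub_mul]
    rw [show w.length + 1 + 1 = 2 + w.length by ring, pow_add]
    exact smul_mul_mem_smul_mul (hx _ _) (prod_map_mem_span_pow x w)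
  | trans h₁ _ ih₁ ih₂ =>
    rw [← h₁.length_eq] at ih₂
    simpa using add_mem ih₁ ih₂

lemma span_pow_eq_span_words (x : σ → P) (d : ℕ) :
    Submodule.span A (Set.range x) ^ d
      = Submodule.span A {p | ∃ w : List σ, w.length = d ∧ (w.map x).prod = p} := by
  refine le_antisymm ?_ (Submodule.span_le.2 ?_)
  · induction d with
    | zero =>
      rw [pow_zero, Submodule.one_eq_span, Submodule.span_le, Set.singleton_subset_iff]
      exact Submodule.subset_span ⟨[], rfl, rfl⟩
    | succ d ih =>
      rw [pow_succ']
      refine (mul_le_mul_right ih _).trans ?_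
      rw [Submodule.span_mul_span, Submodule.span_le]
      rintro _ ⟨_, ⟨s, rfl⟩, _, ⟨w, hw, rfl⟩, rfl⟩
      exact Submodule.subset_span ⟨s :: w, by simp [hw], by simp⟩
  · rintro _ ⟨w, rfl, rfl⟩
    exact prod_map_mem_span_pow x w

lemma prod_flatMap_replicate {M : Type*} [Monoid M] (l : List σ) (x : σ → M) (m : σ → ℕ) :
    ((l.flatMap fun s => List.replicate (m s) s).map x).prod = orderedMonomial l x m := by
  induction l with
  | nil => simp [orderedMonomial]
  | cons s l ih =>
    simp only [orderedMonomial] at ih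
    simp [orderedMonomial, ih]

lemma perm_flatMap_replicate_count [DecidableEq σ] {l : List σ} (hl : l.Nodup)
    (hmem : ∀ s, s ∈ l) (w : List σ) :
    w.Perm (l.flatMap fun s => List.replicate (w.count s) s) := by
  rw [List.perm_iff_count]
  intro a
  rw [List.count_flatMap]
  have h : (List.count a ∘ fun s => List.replicate (w.count s) s)
      = fun s => if s = a then w.count a else 0 := by
    funext s
    by_cases hs : s = a
    · subst hs; simp
    · simp [List.count_replicate, hs]
  rw [h, ← List.sum_toFinset _ hl]
  simp [hmem a]

/-- Nakayama's lemma: if the generators commute modulo the maximal ideal, then every word is a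
combination of the monomials ordered along any fixed enumeration of the generators. -/
lemma span_pow_le_span_orderedMonomial [IsLocalRing A] [Finite σ] {x : σ → P}
    (hx : ∀ s t, x s * x t - x t * x s ∈
      maximalIdeal A • Submodule.span A (Set.range x) ^ 2)
    {l : List σ} (hl : l.Nodup) (hmem : ∀ s, s ∈ l) (d : ℕ) :
    Submodule.span A (Set.range x) ^ d
      ≤ Submodule.span A (Set.range fun m : σ → ℕ => orderedMonomial l x m) := by
  classical
  refine Submodule.le_of_le_smul_of_le_jacobson_bot (I := maximalIdeal A)
    (Submodule.FG.pow (Submodule.fg_span (Set.finite_range x)) d)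
    (IsLocalRing.maximalIdeal_le_jacobson _) ?_
  conv_lhs => rw [span_pow_eq_span_words]
  rw [Submodule.span_le]
  rintro _ ⟨w, rfl, rfl⟩
  have h := prod_sub_prod_mem_of_perm hx (perm_flatMap_replicate_count hl hmem w)
  rw [prod_flatMap_replicate] at h
  rw [← add_sub_cancel (orderedMonomial l x fun s => w.count s) (w.map x).prod]
  exact add_mem (Submodule.mem_sup_left (Submodule.subset_span ⟨_, rfl⟩))
    (Submodule.mem_sup_right h)

lemma adjoin_le_span_orderedMonomial {K : Type*} [Field K] [Algebra A K] [Algebra K P]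
    [IsScalarTower A K P] [IsLocalRing A] [Finite σ] {x : σ → P}
    (hx : ∀ s t, x s * x t - x t * x s ∈
      maximalIdeal A • Submodule.span A (Set.range x) ^ 2)
    {l : List σ} (hl : l.Nodup) (hmem : ∀ s, s ∈ l) :
    Subalgebra.toSubmodule (Algebra.adjoin K (Set.range x))
      ≤ Submodule.span K (Set.range fun m : σ → ℕ => orderedMonomial l x m) := by
  rw [Algebra.adjoin_eq_span, Submodule.span_le]
  intro p hp
  obtain ⟨L, hL, rfl⟩ := Submonoid.exists_list_of_mem_closure hp
  obtain ⟨w, rfl⟩ : L ∈ Set.range (List.map x) := by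
    rw [Set.range_list_map]
    exact hL
  exact Submodule.span_le_restrictScalars A K _
    (span_pow_le_span_orderedMonomial hx hl hmem _ (prod_map_mem_span_pow x w))

end Spanning

section Independence

variable {A K : Type*} [CommRing A] [IsDomain A] [ValuationRing A] [Field K] [Algebra A K]
  [IsFractionRing A K]

/-- A finite family of fractions, not all zero, can be rescaled to be integral with an entry `1`. -/
lemma exists_smul_integral {κ : Type*} (s : Finset κ) (c : κ → K) (hc : ∃ i ∈ s, c i ≠ 0) :
    ∃ (r : K) (a : κ → A), (∀ i ∈ s, r * c i = algebraMap A K (a i)) ∧ ∃ i ∈ s, a i = 1 := by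
  classical
  obtain ⟨i₀, hi₀, hne⟩ := hc
  -- Divide by a coefficient of largest valuation.
  obtain ⟨j, hj, hmax⟩ := s.exists_max_image (fun i => ValuationRing.valuation A K (c i)) ⟨i₀, hi₀⟩
  have hcj : c j ≠ 0 := by
    intro h
    have := hmax i₀ hi₀
    rw [h, map_zero, le_zero_iff, map_eq_zero] at this
    exact hne this
  have key : ∀ i ∈ s, ∃ a : A, algebraMap A K a = (c j)⁻¹ * c i := by
    intro i hi
    rw [← ValuationRing.mem_integer_iff, Valuation.mem_integer_iff, map_mul, map_inv₀]
    exact inv_mul_le_one_of_le₀ (hmax i hi) zero_le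
  choose! a ha using key
  refine ⟨(c j)⁻¹, a, fun i hi => (ha i hi).symm, j, hj, ?_⟩
  apply IsFractionRing.injective A K
  rw [ha j hj, inv_mul_cancel₀ hcj, map_one]

lemma map_orderedMonomial {σ M N F : Type*} [Monoid M] [Monoid N] [FunLike F M N]
    [MonoidHomClass F M N] (f : F) (l : List σ) (x : σ → M) (m : σ → ℕ) :
    f (orderedMonomial l x m) = orderedMonomial l (fun s => f (x s)) m := by
  simp [orderedMonomial, map_list_prod, Function.comp_def]

lemma orderedMonomial_eq_aeval {σ k C : Type*} [CommRing k] [CommRing C] [Algebra k C]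
    {l : List σ} (hl : l.Nodup) (hmem : ∀ s, s ∈ l) (x : σ → C) (m : σ →₀ ℕ) :
    orderedMonomial l x m = MvPolynomial.aeval x (MvPolynomial.monomial m (1 : k)) := by
  classical
  rw [MvPolynomial.aeval_monomial, map_one, one_mul, orderedMonomial, ← List.prod_toFinset _ hl,
    Finsupp.prod_of_support_subset _ (fun s _ => List.mem_toFinset.2 (hmem s)) _ (by simp)]

/-- Ordered monomials are linearly independent over the fraction field `K` of `A` as soon as some
`A`-form `y` of the generators reduces to algebraically independent elements over the residue
field. -/
theorem linearIndependent_orderedMonomial {P E B C σ : Type*} [Ring P] [Algebra K P] [Ring E]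
    [Algebra K E] [Algebra A E] [IsScalarTower A K E] [Ring B] [Algebra A B] [CommRing C]
    [Algebra A C] [Algebra (ResidueField A) C] [IsScalarTower A (ResidueField A) C] [Finite σ]
    (φ : P →ₐ[K] E) {f : B →ₐ[A] E} (hf : Function.Injective f) (π : B →ₐ[A] C)
    {x : σ → P} {y : σ → B} (hxy : ∀ s, φ (x s) = f (y s))
    (hy : AlgebraicIndependent (ResidueField A) fun s => π (y s))
    {l : List σ} (hl : l.Nodup) (hmem : ∀ s, s ∈ l) :
    LinearIndependent K fun m : σ → ℕ => orderedMonomial l x m := by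
  classical
  rw [linearIndependent_iff']
  intro S c hc
  by_contra! hne
  obtain ⟨r, a, ha, i, hi, hai⟩ := exists_smul_integral (A := A) S c hne
  have h₁ : f (∑ m ∈ S, a m • orderedMonomial l y m) = 0 := by
    have := congrArg (fun p => r • φ p) hc
    simp only [map_sum, map_smul, map_zero, smul_zero, Finset.smul_sum, smul_smul,
      map_orderedMonomial, hxy] at this
    rw [← this, map_sum]
    refine Finset.sum_congr rfl fun m hm => ?_
    rw [map_smul, map_orderedMonomial, ha m hm, algebraMap_smul]
  have h₂ : ∑ m ∈ S, a m • orderedMonomial l y m = 0 := hf (by rw [h₁, map_zero])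
  have h₃ := congrArg π h₂
  simp only [map_sum, map_smul, map_zero, map_orderedMonomial] at h₃
  have h₄ : MvPolynomial.aeval (fun s => π (y s)) (∑ m ∈ S,
      MvPolynomial.monomial (Finsupp.equivFunOnFinite.symm m) (residue A (a m))) = 0 := by
    rw [← h₃, map_sum]
    refine Finset.sum_congr rfl fun m _ => ?_
    have := orderedMonomial_eq_aeval (k := ResidueField A) hl hmem (fun s => π (y s))
      (Finsupp.equivFunOnFinite.symm m)
    rw [Finsupp.coe_equivFunOnFinite_symm] at this
    rw [this, ← mul_one (residue A (a m)), ← smul_eq_mul, ← MvPolynomial.smul_monomial, map_smul,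
      ← algebraMap_smul (ResidueField A) (a m)]
    rfl
  have h₅ := (injective_iff_map_eq_zero _).1 hy _ h₄
  have h₆ := congrArg (MvPolynomial.coeff (Finsupp.equivFunOnFinite.symm i)) h₅
  rw [MvPolynomial.coeff_sum, Finset.sum_eq_single_of_mem i hi] at h₆
  · rw [MvPolynomial.coeff_monomial, if_pos rfl, hai, map_one, MvPolynomial.coeff_zero] at h₆
    exact one_ne_zero h₆
  · intro j _ hj
    rw [MvPolynomial.coeff_monomial, if_neg]
    exact fun h => hj (Finsupp.equivFunOnFinite.symm.injective h)

end Independence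

lemma isBasisOf_of_linearIndependent {κ P : Type} [Ring P] [Algebra Kq P] {S : Subalgebra Kq P}
    {v : κ → P} (hv : LinearIndependent Kq v) (hS : ∀ i, v i ∈ S)
    (hspan : Subalgebra.toSubmodule S ≤ Submodule.span Kq (Set.range v)) : IsBasisOf S v := by
  have hli : LinearIndependent Kq fun i => (⟨v i, hS i⟩ : S) :=
    LinearIndependent.of_comp S.val.toLinearMap hv
  refine ⟨Module.Basis.mk hli ?_, fun m => congrArg Subtype.val (Module.Basis.mk_apply hli _ m)⟩
  rintro ⟨p, hp⟩ -
  have hmap : Submodule.map S.val.toLinearMap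
      (Submodule.span Kq (Set.range fun i => (⟨v i, hS i⟩ : S)))
        = Submodule.span Kq (Set.range v) := by
    rw [Submodule.map_span, ← Set.range_comp]
    rfl
  obtain ⟨y, hy, hyp⟩ := hmap.symm ▸ hspan hp
  rwa [← (Subtype.ext hyp : y = ⟨p, hp⟩)]

/-! ### Quantum matrices and the R-matrix -/

section QuantumMatrix

variable {R B ι : Type*} [CommRing R] [Ring B] [Algebra R B] [LinearOrder ι]

/-- The entries of `T` satisfy the relations of the quantized function algebra with parameter `u`,
written uniformly as the entries of `R T₁ T₂ = T₂ T₁ R`. -/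
def IsQuantumMatrix (u : Rˣ) (T : Matrix ι ι B) : Prop :=
  ∀ i j k l, (if i = j then (u : R) else 1) • (T i k * T j l)
      + (if j < i then (u - ↑u⁻¹ : R) else 0) • (T j k * T i l)
    = (if k = l then (u : R) else 1) • (T j l * T i k)
      + (if k < l then (u - ↑u⁻¹ : R) else 0) • (T j k * T i l)

/-- The R-matrix of the vector representation of quantum `gl_N`, over any ring with a parameter. -/
def rMatrix (u : Rˣ) : Matrix (ι × ι) (ι × ι) R :=
  Matrix.of fun p r => (if p = r then if p.1 = p.2 then (u : R) else 1 else 0)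
    + if p = r.swap then if p.2 < p.1 then (u - ↑u⁻¹ : R) else 0 else 0

/-- Transposition in the first tensor leg. -/
def partialTranspose {S : Type*} (M : Matrix (ι × ι) (ι × ι) S) : Matrix (ι × ι) (ι × ι) S :=
  Matrix.of fun p r => M (r.1, p.2) (p.1, r.2)

/-- The matrix `T ⊗ 1`. -/
def leg₁ {S : Type*} [Zero S] (T : Matrix ι ι S) : Matrix (ι × ι) (ι × ι) S :=
  Matrix.of fun p r => if p.2 = r.2 then T p.1 r.1 else 0

/-- The matrix `1 ⊗ T`. -/
def leg₂ {S : Type*} [Zero S] (T : Matrix ι ι S) : Matrix (ι × ι) (ι × ι) S :=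
  Matrix.of fun p r => if p.1 = r.1 then T p.2 r.2 else 0

lemma leg₁_map {S S' : Type*} [Zero S] [Zero S'] (f : S → S') (hf : f 0 = 0) (T : Matrix ι ι S) :
    (leg₁ T).map f = leg₁ (T.map f) := by
  ext p r
  simp only [leg₁, Matrix.map_apply, Matrix.of_apply]
  split_ifs <;> simp [hf]

lemma leg₂_map {S S' : Type*} [Zero S] [Zero S'] (f : S → S') (hf : f 0 = 0) (T : Matrix ι ι S) :
    (leg₂ T).map f = leg₂ (T.map f) := by
  ext p r
  simp only [leg₂, Matrix.map_apply, Matrix.of_apply]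
  split_ifs <;> simp [hf]

variable [Fintype ι]

lemma leg₁_mul (S T : Matrix ι ι B) : leg₁ (S * T) = leg₁ S * leg₁ T := by
  ext p r
  simp only [leg₁, Matrix.mul_apply, Matrix.of_apply, Fintype.sum_prod_type, ite_mul, zero_mul,
    mul_ite, mul_zero]
  by_cases h : p.2 = r.2 <;> simp [h]

lemma leg₂_mul (S T : Matrix ι ι B) : leg₂ (S * T) = leg₂ S * leg₂ T := by
  ext p r
  simp only [leg₂, Matrix.mul_apply, Matrix.of_apply, Fintype.sum_prod_type_right, ite_mul,
    zero_mul, mul_ite, mul_zero]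
  by_cases h : p.1 = r.1 <;> simp [h]

lemma leg₁_mul_leg₂_apply (S T : Matrix ι ι B) (i j k l : ι) :
    (leg₁ S * leg₂ T) (i, j) (k, l) = S i k * T j l := by
  simp [leg₁, leg₂, Matrix.mul_apply, Fintype.sum_prod_type]

lemma leg₂_mul_leg₁_apply (S T : Matrix ι ι B) (i j k l : ι) :
    (leg₂ S * leg₁ T) (i, j) (k, l) = S j l * T i k := by
  simp [leg₁, leg₂, Matrix.mul_apply, Fintype.sum_prod_type]

lemma leg₁_mul_leg₂_comm {S T : Matrix ι ι B} (h : ∀ i j k l, Commute (S i k) (T j l)) :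
    leg₁ S * leg₂ T = leg₂ T * leg₁ S := by
  ext ⟨i, j⟩ ⟨k, l⟩
  rw [leg₁_mul_leg₂_apply, leg₂_mul_leg₁_apply, h]

lemma rMatrix_mul_apply (u : Rˣ) (M : Matrix (ι × ι) (ι × ι) B) (i j k l : ι) :
    ((rMatrix u).map (algebraMap R B) * M : Matrix (ι × ι) (ι × ι) B) (i, j) (k, l)
      = (if i = j then (u : R) else 1) • M (i, j) (k, l)
        + (if j < i then (u - ↑u⁻¹ : R) else 0) • M (j, i) (k, l) := by
  simp only [Matrix.mul_apply, Matrix.map_apply, rMatrix, Matrix.of_apply, map_add, add_mul,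
    Finset.sum_add_distrib, apply_ite (algebraMap R B), map_zero, ite_mul, zero_mul]
  congr 1
  · rw [Finset.sum_ite_eq, if_pos (Finset.mem_univ _)]
    split_ifs <;> simp [Algebra.smul_def]
  · rw [Finset.sum_eq_single (j, i)
      (fun r _ hr => if_neg fun h => hr (by rw [← Prod.swap_swap r, ← h]; rfl)) (by simp)]
    split_ifs <;> simp_all [Algebra.smul_def]

lemma mul_rMatrix_apply (u : Rˣ) (M : Matrix (ι × ι) (ι × ι) B) (i j k l : ι) :
    (M * (rMatrix u).map (algebraMap R B) : Matrix (ι × ι) (ι × ι) B) (i, j) (k, l)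
      = (if k = l then (u : R) else 1) • M (i, j) (k, l)
        + (if k < l then (u - ↑u⁻¹ : R) else 0) • M (i, j) (l, k) := by
  simp only [Matrix.mul_apply, Matrix.map_apply, rMatrix, Matrix.of_apply, map_add, mul_add,
    Finset.sum_add_distrib, apply_ite (algebraMap R B), map_zero, mul_ite, mul_zero]
  congr 1
  · rw [Finset.sum_ite_eq', if_pos (Finset.mem_univ _)]
    split_ifs
    · rw [← Algebra.commutes, ← Algebra.smul_def]
    · rw [map_one, mul_one, one_smul]
  · simp only [Prod.swap_prod_mk]
    rw [Finset.sum_ite_eq', if_pos (Finset.mem_univ _)]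
    split_ifs
    · rw [← Algebra.commutes, ← Algebra.smul_def]
    · rw [zero_smul]

lemma isQuantumMatrix_iff (u : Rˣ) (T : Matrix ι ι B) :
    IsQuantumMatrix u T ↔ (rMatrix u).map (algebraMap R B) * (leg₁ T * leg₂ T)
      = leg₂ T * leg₁ T * (rMatrix u).map (algebraMap R B) := by
  rw [← Matrix.ext_iff, IsQuantumMatrix]
  simp only [Prod.forall, rMatrix_mul_apply, mul_rMatrix_apply, leg₁_mul_leg₂_apply,
    leg₂_mul_leg₁_apply]

omit [Fintype ι] in
lemma IsQuantumMatrix.transpose {u : Rˣ} {T : Matrix ι ι B} (hT : IsQuantumMatrix u T) :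
    IsQuantumMatrix u T.transpose := by
  intro i j k l
  simpa only [Matrix.transpose_apply, eq_comm] using (hT l k j i).symm

/-- The coproduct: a product of quantum matrices with mutually commuting entries is a quantum
matrix. -/
lemma IsQuantumMatrix.mul {u : Rˣ} {S T : Matrix ι ι B} (hS : IsQuantumMatrix u S)
    (hT : IsQuantumMatrix u T) (h : ∀ i j k l, Commute (S i k) (T j l)) :
    IsQuantumMatrix u (S * T) := by
  rw [isQuantumMatrix_iff] at *
  have h₁ : leg₁ T * leg₂ S = leg₂ S * leg₁ T :=
    leg₁_mul_leg₂_comm fun i j k l => (h j i l k).symm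
  have h₂ := leg₁_mul_leg₂_comm h
  set r := (rMatrix (ι := ι) u).map (algebraMap R B)
  calc r * (leg₁ (S * T) * leg₂ (S * T))
      = r * (leg₁ S * (leg₁ T * leg₂ S) * leg₂ T) := by simp only [leg₁_mul, leg₂_mul, mul_assoc]
    _ = r * (leg₁ S * leg₂ S) * (leg₁ T * leg₂ T) := by rw [h₁]; simp only [mul_assoc]
    _ = leg₂ S * leg₁ S * (r * (leg₁ T * leg₂ T)) := by rw [hS]; simp only [mul_assoc]
    _ = leg₂ S * (leg₁ S * leg₂ T) * leg₁ T * r := by rw [hT]; simp only [mul_assoc]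
    _ = leg₂ (S * T) * leg₁ (S * T) * r := by rw [h₂]; simp only [leg₁_mul, leg₂_mul, mul_assoc]

omit [Fintype ι] in
lemma IsQuantumMatrix.map {R' B' : Type*} [CommRing R'] [Algebra R R'] [Ring B'] [Algebra R B']
    [Algebra R' B'] [IsScalarTower R R' B'] {u : Rˣ} {u' : R'ˣ}
    (hu : algebraMap R R' u = u') {T : Matrix ι ι B} (hT : IsQuantumMatrix u T) (f : B →ₐ[R] B') :
    IsQuantumMatrix u' (T.map f) := by
  have hu' : algebraMap R R' ↑u⁻¹ = ↑u'⁻¹ := by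
    rw [show u' = Units.map (algebraMap R R').toMonoidHom u from Units.ext hu.symm, ← map_inv]
    rfl
  have key : ∀ (a : R) (b : B), f (a • b) = algebraMap R R' a • f b := fun a b => by
    rw [map_smul, algebraMap_smul]
  intro i j k l
  have := congrArg f (hT i j k l)
  simpa only [map_add, key, map_mul, apply_ite (algebraMap R R'), map_sub, map_zero, map_one, hu,
    hu', Matrix.map_apply] using this

end QuantumMatrix

/-! ### The reflection equation -/

section Reflection

variable {R B ι : Type*} [CommRing R] [Ring B] [Algebra R B] [LinearOrder ι] [Fintype ι]

/-- The partially transposed form of the quantum matrix relations. -/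
lemma IsQuantumMatrix.leg₁_transpose_mul {u : Rˣ} {T : Matrix ι ι B} (hT : IsQuantumMatrix u T) :
    leg₁ T.transpose * (partialTranspose (rMatrix u)).map (algebraMap R B) * leg₂ T
      = leg₂ T * (partialTranspose (rMatrix u)).map (algebraMap R B) * leg₁ T.transpose := by
  ext ⟨i, j⟩ ⟨k, l⟩
  have h := congrFun (congrFun ((isQuantumMatrix_iff u T).1 hT) (k, j)) (i, l)
  rw [Matrix.mul_apply, Matrix.mul_apply] at h
  simp only [leg₁_mul_leg₂_apply, leg₂_mul_leg₁_apply, Fintype.sum_prod_type,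
    Matrix.map_apply] at h
  simp only [Matrix.mul_apply, Fintype.sum_prod_type, leg₁, leg₂, partialTranspose,
    Matrix.map_apply, Matrix.of_apply, Matrix.transpose_apply, ite_mul, zero_mul, mul_ite, mul_zero,
    Finset.sum_ite_eq, Finset.sum_ite_eq', Finset.mem_univ, if_true, Finset.sum_mul]
  rw [Finset.sum_comm]
  simp only [Finset.sum_ite_eq', Finset.mem_univ, if_true]
  have hl : ∀ a b, T b i * algebraMap R B (rMatrix u (k, j) (b, a)) * T a l
      = algebraMap R B (rMatrix u (k, j) (b, a)) * (T b i * T a l) := fun a b => by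
    rw [← Algebra.commutes, mul_assoc]
  have hr : ∀ a, (∑ c, ∑ b, if i = c then
        T j b * algebraMap R B (rMatrix u (a, b) (c, l)) * T k a else 0)
      = ∑ b, T j b * T k a * algebraMap R B (rMatrix u (a, b) (i, l)) := fun a => by
    rw [Finset.sum_comm]
    simp only [Finset.sum_ite_eq, Finset.mem_univ, if_true]
    refine Finset.sum_congr rfl fun b _ => ?_
    rw [mul_assoc, Algebra.commutes, mul_assoc]
  simp only [hl, hr]
  rw [Finset.sum_comm, h]

/-- The formal part of the derivation of the reflection equation. -/
lemma reflection_of_commutation {M : Type*} [Monoid M] {r r' t₁ t₂ s₁ s₂ j₁ j₂ : M}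
    (hj : r * j₁ * r' * j₂ = j₂ * r' * j₁ * r)
    (ht : r * (t₁ * t₂) = t₂ * t₁ * r) (hs : r * (s₁ * s₂) = s₂ * s₁ * r)
    (h₁ : s₁ * r' * t₂ = t₂ * r' * s₁) (h₂ : t₁ * r' * s₂ = s₂ * r' * t₁)
    (hjt₁ : j₁ * t₂ = t₂ * j₁) (hjs₁ : j₁ * s₂ = s₂ * j₁)
    (hjt₂ : t₁ * j₂ = j₂ * t₁) (hjs₂ : s₁ * j₂ = j₂ * s₁) :
    r * (t₁ * j₁ * s₁) * r' * (t₂ * j₂ * s₂) = (t₂ * j₂ * s₂) * r' * (t₁ * j₁ * s₁) * r :=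
  calc r * (t₁ * j₁ * s₁) * r' * (t₂ * j₂ * s₂)
      = r * t₁ * j₁ * (s₁ * r' * t₂) * j₂ * s₂ := by simp only [mul_assoc]
    _ = r * t₁ * (j₁ * t₂) * r' * (s₁ * j₂) * s₂ := by rw [h₁]; simp only [mul_assoc]
    _ = r * (t₁ * t₂) * j₁ * r' * j₂ * s₁ * s₂ := by rw [hjt₁, hjs₂]; simp only [mul_assoc]
    _ = t₂ * t₁ * (r * j₁ * r' * j₂) * s₁ * s₂ := by rw [ht]; simp only [mul_assoc]
    _ = t₂ * t₁ * j₂ * r' * j₁ * (r * (s₁ * s₂)) := by rw [hj]; simp only [mul_assoc]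
    _ = t₂ * (t₁ * j₂) * r' * (j₁ * s₂) * s₁ * r := by rw [hs]; simp only [mul_assoc]
    _ = t₂ * j₂ * (t₁ * r' * s₂) * j₁ * s₁ * r := by rw [hjt₂, hjs₁]; simp only [mul_assoc]
    _ = (t₂ * j₂ * s₂) * r' * (t₁ * j₁ * s₁) * r := by rw [h₂]; simp only [mul_assoc]

/-- The scalar matrix `J` solves the reflection equation. -/
def IsReflectionSolution (u : Rˣ) (J : Matrix ι ι R) : Prop :=
  rMatrix u * leg₁ J * partialTranspose (rMatrix u) * leg₂ J
    = leg₂ J * partialTranspose (rMatrix u) * leg₁ J * rMatrix u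

/-- If `J` solves the reflection equation, then so does `T J Tᵗ` for every quantum matrix `T`. -/
theorem IsQuantumMatrix.reflection {u : Rˣ} {T : Matrix ι ι B} (hT : IsQuantumMatrix u T)
    {J : Matrix ι ι R} (hJ : IsReflectionSolution u J) {X : Matrix ι ι B}
    (hX : X = T * J.map (algebraMap R B) * T.transpose) :
    (rMatrix u).map (algebraMap R B) * leg₁ X * (partialTranspose (rMatrix u)).map (algebraMap R B)
        * leg₂ X
      = leg₂ X * (partialTranspose (rMatrix u)).map (algebraMap R B) * leg₁ X
        * (rMatrix u).map (algebraMap R B) := by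
  have hc : ∀ (S : Matrix ι ι B) (i j k l), Commute (J.map (algebraMap R B) i k) (S j l) :=
    fun S i j k l => Algebra.commutes _ _
  rw [hX]
  simp only [leg₁_mul, leg₂_mul]
  refine reflection_of_commutation ?_ ((isQuantumMatrix_iff u T).1 hT)
    ((isQuantumMatrix_iff u _).1 hT.transpose) hT.leg₁_transpose_mul
    hT.transpose.leg₁_transpose_mul
    (leg₁_mul_leg₂_comm (hc _)) (leg₁_mul_leg₂_comm (hc _))
    (leg₁_mul_leg₂_comm fun i j k l => (hc _ j i l k).symm)
    (leg₁_mul_leg₂_comm fun i j k l => (hc _ j i l k).symm)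
  rw [← leg₁_map _ (map_zero _), ← leg₂_map _ (map_zero _)]
  simp only [← Matrix.map_mul]
  rw [hJ]

end Reflection

/-! ### Commutators modulo the parameter -/

section Commutators

variable {A P ι : Type*} [CommRing A] [Ring P] [Algebra A P]

lemma mul_scalar_mul_apply_mem {n : Type*} [Fintype n] {I : Ideal A} {V : Submodule A P}
    {S T : Matrix n n P} {N : Matrix n n A} (hS : ∀ p r, S p r ∈ V) (hT : ∀ p r, T p r ∈ V)
    (hN : ∀ p r, N p r ∈ I) (p r : n) :
    (S * N.map (algebraMap A P) * T) p r ∈ I • V ^ 2 := by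
  rw [Matrix.mul_apply]
  refine sum_mem fun a _ => ?_
  rw [Matrix.mul_apply, Finset.sum_mul]
  refine sum_mem fun b _ => ?_
  rw [Matrix.map_apply, ← Algebra.commutes, mul_assoc, ← Algebra.smul_def, sq]
  exact Submodule.smul_mem_smul (hN _ _) (Submodule.mul_mem_mul (hS _ _) (hT _ _))

lemma scalar_mul_apply_mem {n : Type*} [Fintype n] {I : Ideal A} {W : Submodule A P}
    {M : Matrix n n P} {N : Matrix n n A} (hM : ∀ p r, M p r ∈ W)
    (hN : ∀ p r, N p r ∈ I) (p r : n) :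
    (N.map (algebraMap A P) * M) p r ∈ I • W := by
  rw [Matrix.mul_apply]
  refine sum_mem fun a _ => ?_
  rw [Matrix.map_apply, ← Algebra.smul_def]
  exact Submodule.smul_mem_smul (hN _ _) (hM _ _)

lemma mul_scalar_apply_mem {n : Type*} [Fintype n] {I : Ideal A} {W : Submodule A P}
    {M : Matrix n n P} {N : Matrix n n A} (hM : ∀ p r, M p r ∈ W)
    (hN : ∀ p r, N p r ∈ I) (p r : n) :
    (M * N.map (algebraMap A P)) p r ∈ I • W := by
  rw [Matrix.mul_apply]
  refine sum_mem fun a _ => ?_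
  rw [Matrix.map_apply, ← Algebra.commutes, ← Algebra.smul_def]
  exact Submodule.smul_mem_smul (hN _ _) (hM _ _)

lemma sub_inv_mem {I : Ideal A} {u : Aˣ} (hu : (u - 1 : A) ∈ I) : (u - ↑u⁻¹ : A) ∈ I := by
  have : (u - ↑u⁻¹ : A) = (↑u⁻¹ * (u + 1)) * (u - 1) := by
    have := u.inv_mul
    linear_combination (-u : A) * this
  rw [this]
  exact I.mul_mem_left _ hu

variable [LinearOrder ι]

lemma IsQuantumMatrix.commutator_mem {I : Ideal A} {u : Aˣ} (hu : (u - 1 : A) ∈ I)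
    {T : Matrix ι ι P} (hT : IsQuantumMatrix u T) {V : Submodule A P} (hV : ∀ i j, T i j ∈ V)
    (i j k l : ι) : T i k * T j l - T j l * T i k ∈ I • V ^ 2 := by
  have hc : ∀ p : Prop, [Decidable p] → ((if p then (u : A) else 1) - 1) ∈ I := by
    intro p _; split_ifs <;> simp [hu]
  have hd : ∀ p : Prop, [Decidable p] → (if p then (u - ↑u⁻¹ : A) else 0) ∈ I := by
    intro p _; split_ifs <;> simp [sub_inv_mem hu]
  have hm : ∀ i j k l, T i j * T k l ∈ V ^ 2 := fun i j k l => by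
    rw [sq]; exact Submodule.mul_mem_mul (hV _ _) (hV _ _)
  have key : T i k * T j l - T j l * T i k
      = ((if k = l then (u : A) else 1) - 1) • (T j l * T i k)
        + (if k < l then (u - ↑u⁻¹ : A) else 0) • (T j k * T i l)
        - ((if i = j then (u : A) else 1) - 1) • (T i k * T j l)
        - (if j < i then (u - ↑u⁻¹ : A) else 0) • (T j k * T i l) := by
    have h := hT i j k l
    simp only [sub_smul, one_smul]
    rw [← sub_eq_zero] at h ⊢
    refine Eq.trans ?_ h
    abel
  rw [key]
  exact sub_mem (sub_mem (add_mem (Submodule.smul_mem_smul (hc _) (hm _ _ _ _))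
    (Submodule.smul_mem_smul (hd _) (hm _ _ _ _))) (Submodule.smul_mem_smul (hc _) (hm _ _ _ _)))
    (Submodule.smul_mem_smul (hd _) (hm _ _ _ _))

/-- A solution of the reflection equation has commuting entries modulo `u - 1`, because both the
R-matrix and its partial transpose reduce to the identity. -/
lemma commutator_mem_of_reflection [Fintype ι] {I : Ideal A} {u : Aˣ} (hu : (u - 1 : A) ∈ I)
    {X : Matrix ι ι P}
    (hX : (rMatrix u).map (algebraMap A P) * leg₁ X *
        (partialTranspose (rMatrix u)).map (algebraMap A P) * leg₂ X
      = leg₂ X * (partialTranspose (rMatrix u)).map (algebraMap A P) * leg₁ X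
        * (rMatrix u).map (algebraMap A P))
    {V : Submodule A P} (hV : ∀ i j, X i j ∈ V) (i j k l : ι) :
    X i k * X j l - X j l * X i k ∈ I • V ^ 2 := by
  have hR : ∀ p r : ι × ι, (rMatrix u - 1) p r ∈ I := by
    intro p r
    simp only [rMatrix, Matrix.sub_apply, Matrix.of_apply, Matrix.one_apply]
    rw [add_sub_right_comm]
    refine add_mem ?_ ?_ <;> split_ifs <;> simp [hu, sub_inv_mem hu]
  have hR' : ∀ p r : ι × ι, (partialTranspose (rMatrix u) - 1) p r ∈ I := by
    intro p r
    have := hR (r.1, p.2) (p.1, r.2)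
    rw [Matrix.sub_apply, Matrix.one_apply] at this ⊢
    have e : (p = r) = ((r.1, p.2) = (p.1, r.2)) := by
      simp only [Prod.ext_iff, eq_comm (a := p.1)]
    simp only [e]
    exact this
  have h₁ : ∀ p r, leg₁ X p r ∈ V := by
    intro p r; simp only [leg₁, Matrix.of_apply]; split_ifs <;> simp [hV]
  have h₂ : ∀ p r, leg₂ X p r ∈ V := by
    intro p r; simp only [leg₂, Matrix.of_apply]; split_ifs <;> simp [hV]
  have htop : ∀ p r : ι × ι, partialTranspose (rMatrix u) p r ∈ (⊤ : Ideal A) :=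
    fun _ _ => Submodule.mem_top
  have e₁ := mul_scalar_mul_apply_mem h₁ h₂ hR' (i, j) (k, l)
  have e₂ := mul_scalar_mul_apply_mem h₂ h₁ hR' (i, j) (k, l)
  have e₃ := scalar_mul_apply_mem (mul_scalar_mul_apply_mem h₁ h₂ htop) hR (i, j) (k, l)
  have e₄ := mul_scalar_apply_mem (mul_scalar_mul_apply_mem h₂ h₁ htop) hR (i, j) (k, l)
  rw [Submodule.top_smul] at e₃ e₄
  have hmap : ∀ N : Matrix (ι × ι) (ι × ι) A,
      (N - 1).map (algebraMap A P) = N.map (algebraMap A P) - 1 := fun N => by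
    rw [Matrix.map_sub _ (map_sub _), Matrix.map_one _ (map_zero _) (map_one _)]
  have key : leg₁ X * leg₂ X - leg₂ X * leg₁ X
      = leg₂ X * (partialTranspose (rMatrix u) - 1).map (algebraMap A P) * leg₁ X
        - leg₁ X * (partialTranspose (rMatrix u) - 1).map (algebraMap A P) * leg₂ X
        + (leg₂ X * (partialTranspose (rMatrix u)).map (algebraMap A P) * leg₁ X)
          * (rMatrix u - 1).map (algebraMap A P)
        - (rMatrix u - 1).map (algebraMap A P)
          * (leg₁ X * (partialTranspose (rMatrix u)).map (algebraMap A P) * leg₂ X) := by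
    simp only [hmap, mul_sub, sub_mul, mul_one, one_mul, ← mul_assoc]
    rw [hX]
    abel
  rw [← leg₁_mul_leg₂_apply X X i j k l, ← leg₂_mul_leg₁_apply X X i j k l, ← Matrix.sub_apply, key]
  exact sub_mem (add_mem (sub_mem e₂ e₁) e₄) e₃

end Commutators

/-! ### The constant solutions of the reflection equation -/

section Solutions

lemma isReflectionSolution_one {R ι : Type*} [CommRing R] [LinearOrder ι] [Fintype ι] (u : Rˣ) :
    IsReflectionSolution u (1 : Matrix ι ι R) := by
  have h₁ : leg₁ (1 : Matrix ι ι R) = 1 := by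
    ext p r
    simp only [leg₁, Matrix.of_apply, Matrix.one_apply, Prod.ext_iff]
    split_ifs <;> simp_all
  have h₂ : leg₂ (1 : Matrix ι ι R) = 1 := by
    ext p r
    simp only [leg₂, Matrix.of_apply, Matrix.one_apply, Prod.ext_iff]
    split_ifs <;> simp_all
  rw [IsReflectionSolution, h₁, h₂]
  simp only [mul_one, one_mul]
  ext ⟨i, j⟩ ⟨k, l⟩
  have e₁ := rMatrix_mul_apply u (partialTranspose (rMatrix u)) i j k l
  have e₂ := mul_rMatrix_apply u (partialTranspose (rMatrix u)) i j k l
  rw [Algebra.algebraMap_self, RingHom.coe_id, Matrix.map_id] at e₁ e₂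
  rw [e₁, e₂]
  simp only [partialTranspose, rMatrix, Matrix.of_apply, Prod.mk.injEq, Prod.swap_prod_mk,
    smul_eq_mul]
  grind

/-- The fixed-point free involution exchanging the indices `2k` and `2k + 1`. -/
def partner {n : ℕ} (i : Fin (2 * n)) : Fin (2 * n) :=
  ⟨if (i : ℕ) % 2 = 0 then i + 1 else i - 1, by have := i.2; split_ifs <;> omega⟩

lemma partner_partner {n : ℕ} (i : Fin (2 * n)) : partner (partner i) = i := by
  ext; simp only [partner]; split_ifs <;> omega

/-- The nonzero entry in row `i` of the matrix `J` of type AII, rows being numbered from `0`. -/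
def sympCoeff {R : Type*} [CommRing R] (u : R) {n : ℕ} (i : Fin (2 * n)) : R :=
  if (i : ℕ) % 2 = 0 then 1 else -u

lemma partner_cases {R : Type*} [CommRing R] (u : R) {n : ℕ} (i : Fin (2 * n)) :
    (i < partner i ∧ sympCoeff u i = 1 ∧ sympCoeff u (partner i) = -u) ∨
      (partner i < i ∧ sympCoeff u i = -u ∧ sympCoeff u (partner i) = 1) := by
  simp only [sympCoeff, partner, Fin.lt_def]
  rcases Nat.mod_two_eq_zero_or_one i with h | h
  · left
    simp [h, Nat.add_mod]
  · right
    have : ((i : ℕ) - 1) % 2 = 0 := by omega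
    simp only [h]
    simp
    omega

/-- Distinct blocks `{2k, 2k + 1}` are comparable as a whole. -/
lemma partner_trichotomy {n : ℕ} (i k : Fin (2 * n)) :
    k = i ∨ k = partner i ∨ (i < k ∧ partner i < k ∧ i < partner k ∧ partner i < partner k) ∨
      (k < i ∧ k < partner i ∧ partner k < i ∧ partner k < partner i) := by
  simp only [partner, Fin.ext_iff, Fin.lt_def]
  split_ifs <;> omega

/-- The entries of the reflection equation for the type AII matrix. -/
lemma reflection_entry_sympCoeff {R : Type*} [CommRing R] (u : Rˣ) {n : ℕ} (i j k l : Fin (2 * n)) :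
    (if i = j then (u : R) else 1) *
        (sympCoeff (u : R) i * sympCoeff (u : R) (partner l)
          * rMatrix u (k, j) (partner i, partner l))
      + (if j < i then (u - ↑u⁻¹ : R) else 0) *
        (sympCoeff (u : R) j * sympCoeff (u : R) (partner l)
          * rMatrix u (k, i) (partner j, partner l))
    = (if k = l then (u : R) else 1) *
        (sympCoeff (u : R) j * sympCoeff (u : R) (partner k)
          * rMatrix u (partner k, partner j) (i, l))
      + (if k < l then (u - ↑u⁻¹ : R) else 0) *
        (sympCoeff (u : R) j * sympCoeff (u : R) (partner l)
          * rMatrix u (partner l, partner j) (i, k)) := by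
  obtain ⟨w, v, huv, hvu⟩ := u
  simp only [rMatrix, Matrix.of_apply, Prod.mk.injEq, Prod.swap_prod_mk, Units.inv_mk]
  by_cases hj : j = partner i
  · subst hj
    simp only [partner_partner]
    by_cases hl : l = partner k
    · subst hl
      simp only [partner_partner]
      -- Only the order of the blocks of `i` and `k` and the parities of `i` and `k` matter.
      have h₁ := partner_cases w i
      have h₂ := partner_cases w k
      have h₃ := partner_trichotomy i k
      have h₄ := partner_partner i
      generalize hi' : partner i = i' at *
      generalize hk' : partner k = k' at *
      generalize sympCoeff w i = c₁ at *
      generalize sympCoeff w k = c₂ at *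
      generalize sympCoeff w i' = c₃ at *
      generalize sympCoeff w k' = c₄ at *
      rcases h₁ with ⟨h₁, rfl, rfl⟩ | ⟨h₁, rfl, rfl⟩ <;>
      rcases h₂ with ⟨h₂, rfl, rfl⟩ | ⟨h₂, rfl, rfl⟩ <;>
      rcases h₃ with rfl | rfl | h₃ | h₃ <;> grind
    · have h₁ : partner l ≠ k := fun h => hl (by rw [← h, partner_partner])
      grind
  -- Otherwise `i` and `j` lie in different blocks or agree, and a nonzero term forces `(k, l)` to
  -- be `(σ i, σ j)` or `(σ j, σ i)`, where `σ` is the exchange of partners.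
  · have h₁ : partner j ≠ i := fun h => hj (by rw [← h, partner_partner])
    have h₂ := partner_trichotomy i j
    have h₃ := partner_partner i
    have h₄ := partner_partner j
    have h₅ := partner_partner k
    have h₆ := partner_partner l
    by_cases hk : k = partner i ∧ l = partner j
    · obtain ⟨rfl, rfl⟩ := hk
      grind
    by_cases hk' : k = partner j ∧ l = partner i
    · obtain ⟨rfl, rfl⟩ := hk'
      grind
    grind

/-- The matrix `J` of type AII over any ring with a parameter `u` in place of `q`. -/
def sympMatrix {R : Type*} [CommRing R] (u : R) (n : ℕ) : Matrix (Fin (2 * n)) (Fin (2 * n)) R :=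
  Matrix.of fun i j => if j = partner i then sympCoeff u i else 0

lemma isReflectionSolution_sympMatrix {R : Type*} [CommRing R] (u : Rˣ) (n : ℕ) :
    IsReflectionSolution u (sympMatrix (u : R) n) := by
  have l₁ : ∀ (M : Matrix (Fin (2 * n) × Fin (2 * n)) (Fin (2 * n) × Fin (2 * n)) R) i j p,
      (leg₁ (sympMatrix (u : R) n) * M) (i, j) p = sympCoeff (u : R) i * M (partner i, j) p := by
    intro M i j p
    rw [Matrix.mul_apply, Finset.sum_eq_single (partner i, j)] <;>
      simp +contextual [leg₁, sympMatrix]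
    grind
  have l₂ : ∀ (M : Matrix (Fin (2 * n) × Fin (2 * n)) (Fin (2 * n) × Fin (2 * n)) R) i j p,
      (leg₂ (sympMatrix (u : R) n) * M) (i, j) p = sympCoeff (u : R) j * M (i, partner j) p := by
    intro M i j p
    rw [Matrix.mul_apply, Finset.sum_eq_single (i, partner j)] <;>
      simp +contextual [leg₂, sympMatrix]
  have r₁ : ∀ (M : Matrix (Fin (2 * n) × Fin (2 * n)) (Fin (2 * n) × Fin (2 * n)) R) p k l,
      (M * leg₁ (sympMatrix (u : R) n)) p (k, l)
        = sympCoeff (u : R) (partner k) * M p (partner k, l) := by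
    intro M p k l
    rw [Matrix.mul_apply, Finset.sum_eq_single (partner k, l)] <;>
      simp +contextual [leg₁, sympMatrix, partner_partner, mul_comm]
    exact fun a b h hb hk => absurd hb (h (by rw [hk, partner_partner]))
  have r₂ : ∀ (M : Matrix (Fin (2 * n) × Fin (2 * n)) (Fin (2 * n) × Fin (2 * n)) R) p k l,
      (M * leg₂ (sympMatrix (u : R) n)) p (k, l)
        = sympCoeff (u : R) (partner l) * M p (k, partner l) := by
    intro M p k l
    rw [Matrix.mul_apply, Finset.sum_eq_single (k, partner l)] <;>
      simp +contextual [leg₂, sympMatrix, partner_partner, mul_comm]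
    exact fun a b h ha hl => absurd (by rw [hl, partner_partner]) (h ha)
  rw [IsReflectionSolution, mul_assoc, mul_assoc, ← mul_assoc (leg₁ _)]
  ext ⟨i, j⟩ ⟨k, l⟩
  have e₁ := rMatrix_mul_apply u (leg₁ (sympMatrix (u : R) n) * partialTranspose (rMatrix u)
    * leg₂ (sympMatrix (u : R) n)) i j k l
  have e₂ := mul_rMatrix_apply u (leg₂ (sympMatrix (u : R) n) * partialTranspose (rMatrix u)
    * leg₁ (sympMatrix (u : R) n)) i j k l
  rw [Algebra.algebraMap_self, RingHom.coe_id, Matrix.map_id] at e₁ e₂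
  rw [e₁, e₂]
  simp only [l₁, l₂, r₁, r₂, smul_eq_mul, partialTranspose, Matrix.of_apply]
  linear_combination reflection_entry_sympCoeff u i j k l

lemma jAII_eq (n : ℕ) : jAII n = sympMatrix q n := by
  ext i j
  have hi : (i : ℕ) / 2 < n := by omega
  rw [jAII, Matrix.sum_apply, Finset.sum_eq_single ⟨(i : ℕ) / 2, hi⟩ _ (by simp)]
  · simp only [Matrix.sub_apply, Matrix.smul_apply, Matrix.single_apply, sympMatrix, partner,
      sympCoeff, Matrix.of_apply, Fin.ext_iff, smul_eq_mul]
    rcases Nat.mod_two_eq_zero_or_one i with h | h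
    · have h₁ : 2 * ((i : ℕ) / 2) = i := by omega
      simp [h, h₁, eq_comm]
    · have h₁ : 2 * ((i : ℕ) / 2) + 1 = i := by omega
      have h₂ : 2 * ((i : ℕ) / 2) = i - 1 := by omega
      have h₃ : (i : ℕ) - 1 ≠ i := by omega
      have h₄ : (i : ℕ) = i - 1 + 1 := by omega
      simp only [h, h₂, h₃, ← h₄, eq_comm (a := (j : ℕ))]
      by_cases hj : (i : ℕ) - 1 = j <;> simp [hj]
  · intro k _ hk
    have h₁ : 2 * (k : ℕ) ≠ i := fun h => hk (Fin.ext (by simp only; omega))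
    have h₂ : 2 * (k : ℕ) + 1 ≠ i := fun h => hk (Fin.ext (by simp only; omega))
    simp [Fin.ext_iff, h₁, h₂]

end Solutions

/-! ### Symmetries of the entries of `T J Tᵗ` -/

section Symmetry

variable {R B : Type*} [CommRing R] [Ring B] [Algebra R B]

/-- The relations in a pair of rows, summed over the columns. -/
lemma IsQuantumMatrix.symm_entry {ι : Type*} [LinearOrder ι] [Fintype ι] {u : Rˣ}
    {T : Matrix ι ι B} (hT : IsQuantumMatrix u T) {i j : ι} (hij : i < j) :
    (T * T.transpose) i j = (u : R) • (T * T.transpose) j i := by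
  simp only [Matrix.mul_apply, Matrix.transpose_apply, Finset.smul_sum]
  refine Finset.sum_congr rfl fun r _ => ?_
  simpa [hij.ne, hij.not_gt] using hT i j r r

lemma mul_sympMatrix_mul_apply (u : R) {n : ℕ} (T : Matrix (Fin (2 * n)) (Fin (2 * n)) B)
    (i j : Fin (2 * n)) :
    (T * (sympMatrix u n).map (algebraMap R B) * T.transpose) i j
      = ∑ r, sympCoeff u r • (T i r * T j (partner r)) := by
  simp only [Matrix.mul_apply, sympMatrix, Matrix.map_apply, Matrix.of_apply, Finset.sum_mul,
    apply_ite (algebraMap R B), map_zero, mul_ite, mul_zero, ite_mul, zero_mul,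
    Matrix.transpose_apply]
  rw [Finset.sum_comm]
  refine Finset.sum_congr rfl fun r _ => ?_
  rw [Finset.sum_ite_eq', if_pos (Finset.mem_univ _), ← Algebra.commutes, mul_assoc,
    Algebra.smul_def]

/-- A sum over all indices vanishes if it does so on each block `{2k, 2k + 1}`. -/
lemma sum_eq_zero_of_partner {n : ℕ} {f : Fin (2 * n) → B}
    (hf : ∀ r : Fin (2 * n), (r : ℕ) % 2 = 0 → f r + f (partner r) = 0) : ∑ r, f r = 0 := by
  refine Finset.sum_involution (fun r _ => partner r) (fun r _ => ?_) (fun r _ _ => ?_)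
    (fun _ _ => Finset.mem_univ _) (fun r _ => partner_partner r)
  · rcases Nat.mod_two_eq_zero_or_one r with h | h
    · exact hf r h
    · have := hf (partner r) (by simp only [partner]; split_ifs <;> omega)
      rwa [partner_partner, add_comm] at this
  · rcases partner_cases (0 : ℤ) r with h | h
    exacts [h.1.ne', h.1.ne]

lemma partner_of_even (u : R) {n : ℕ} {r : Fin (2 * n)} (hr : (r : ℕ) % 2 = 0) :
    r < partner r ∧ sympCoeff u r = 1 ∧ sympCoeff u (partner r) = -u := by
  rcases partner_cases u r with h | h
  · exact h
  · have := h.1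
    simp [partner, hr, Fin.lt_def] at this

lemma IsQuantumMatrix.symp_entry_self {u : Rˣ} {n : ℕ} {T : Matrix (Fin (2 * n)) (Fin (2 * n)) B}
    (hT : IsQuantumMatrix u T) (i : Fin (2 * n)) :
    (T * (sympMatrix (u : R) n).map (algebraMap R B) * T.transpose) i i = 0 := by
  rw [mul_sympMatrix_mul_apply]
  refine sum_eq_zero_of_partner fun r hr => ?_
  obtain ⟨h₁, h₂, h₃⟩ := partner_of_even (u : R) hr
  have := hT i i (partner r) r
  simp only [if_true, lt_irrefl, if_false, h₁.ne', h₁.not_gt, zero_smul, add_zero, one_smul] at this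
  rw [h₂, h₃, partner_partner, neg_smul, this, one_smul, add_neg_cancel]

lemma IsQuantumMatrix.symp_entry_swap {u : Rˣ} {n : ℕ} {T : Matrix (Fin (2 * n)) (Fin (2 * n)) B}
    (hT : IsQuantumMatrix u T) {i j : Fin (2 * n)} (hij : i < j) :
    (T * (sympMatrix (u : R) n).map (algebraMap R B) * T.transpose) j i
      = -(u : R) • (T * (sympMatrix (u : R) n).map (algebraMap R B) * T.transpose) i j := by
  rw [← sub_eq_zero, mul_sympMatrix_mul_apply, mul_sympMatrix_mul_apply, Finset.smul_sum,
    ← Finset.sum_sub_distrib]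
  refine sum_eq_zero_of_partner fun r hr => ?_
  obtain ⟨h₁, h₂, h₃⟩ := partner_of_even (u : R) hr
  have e₁ := hT i j (partner r) r
  have e₂ := hT i j r (partner r)
  simp only [hij.ne, hij.not_gt, h₁, h₁.ne, h₁.ne', h₁.not_gt, if_true, if_false, zero_smul,
    add_zero, one_smul] at e₁ e₂
  rw [h₂, h₃, partner_partner, e₁, e₂]
  have hu : (u : R) * ↑u⁻¹ = 1 := u.mul_inv
  linear_combination (norm := module) (-1 : R) • hu • (T j r * T i (partner r))

end Symmetry

/-! ### The quantized function algebra -/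

section QMat

lemma q_ne_zero : q ≠ 0 := RatFunc.X_ne_zero

/-- The indeterminate `q` as a unit of the base field. -/
noncomputable def qUnit : Kqˣ := Units.mk0 q q_ne_zero

lemma genT_isQuantumMatrix (N : ℕ) : IsQuantumMatrix qUnit (genT N) := by
  have rel : ∀ {a b}, QMatRel N a b → RingQuot.mkAlgHom Kq (QMatRel N) a
      = RingQuot.mkAlgHom Kq (QMatRel N) b := fun h => RingQuot.mkAlgHom_rel Kq h
  have row : ∀ k i j, i < j → genT N k i * genT N k j = q • (genT N k j * genT N k i) := by
    intro k i j h
    have := rel (QMatRel.row k i j h)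
    simp only [map_mul, map_smul] at this
    exact this
  have col : ∀ k i j, i < j → genT N i k * genT N j k = q • (genT N j k * genT N i k) := by
    intro k i j h
    have := rel (QMatRel.col k i j h)
    simp only [map_mul, map_smul] at this
    exact this
  have anti : ∀ i k j l, i < k → j < l → genT N i l * genT N k j = genT N k j * genT N i l := by
    intro i k j l h h'
    have := rel (QMatRel.anti i k j l h h')
    simp only [map_mul] at this
    exact this
  have diag : ∀ i k j l, i < k → j < l → genT N i j * genT N k l - genT N k l * genT N i j
      = (q - q⁻¹) • (genT N k j * genT N i l) := by
    intro i k j l h h'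
    have := rel (QMatRel.diag i k j l h h')
    simp only [map_mul, map_smul, map_sub] at this
    exact this
  have hq := q_ne_zero
  have hu : (qUnit : Kq) = q := rfl
  have hu' : ((qUnit⁻¹ : Kqˣ) : Kq) = q⁻¹ := rfl
  intro i j k l
  rw [hu, hu']
  rcases lt_trichotomy i j with hij | rfl | hij <;> rcases lt_trichotomy k l with hkl | rfl | hkl
  · simp only [hij.ne, hij.not_gt, hkl.ne, hkl, if_true, if_false, one_smul, zero_smul, add_zero]
    rw [← diag i j k l hij hkl]
    abel
  · simp only [hij.ne, hij.not_gt, lt_irrefl, if_true, if_false, one_smul, zero_smul, add_zero]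
    exact col k i j hij
  · simp only [hij.ne, hij.not_gt, hkl.ne', hkl.not_gt, if_false, one_smul, zero_smul, add_zero]
    exact anti i j l k hij hkl
  · simp only [lt_irrefl, hkl.ne, hkl, if_true, if_false, one_smul, zero_smul, add_zero]
    rw [row i k l hkl, smul_smul, smul_smul, sub_mul, inv_mul_cancel₀ hq, sub_smul, one_smul]
    abel
  · simp
  · simp only [lt_irrefl, hkl.ne', hkl.not_gt, if_true, if_false, one_smul, zero_smul, add_zero]
    exact (row i l k hkl).symm
  · simp only [hij.ne', hij, hkl.ne, hkl, if_true, if_false, one_smul]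
    rw [anti j i k l hij hkl]
  · simp only [hij.ne', hij, lt_irrefl, if_true, if_false, one_smul, zero_smul, add_zero]
    rw [col k j i hij, smul_smul, smul_smul, sub_mul, inv_mul_cancel₀ hq, sub_smul, one_smul]
    abel
  · simp only [hij.ne', hij, hkl.ne', hkl.not_gt, if_true, if_false, one_smul, zero_smul, add_zero]
    rw [anti j i l k hij hkl, ← diag j i l k hij hkl]
    abel

/-- The universal property of `𝒪_q(Mat_N)`: quantum matrices are its points. -/
lemma exists_algHom_of_isQuantumMatrix {E : Type} [Ring E] [Algebra Kq E] {N : ℕ}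
    {T : Matrix (Fin N) (Fin N) E} (hT : IsQuantumMatrix qUnit T) :
    ∃ φ : QMat N →ₐ[Kq] E, ∀ i j, φ (genT N i j) = T i j := by
  have hu : (qUnit : Kq) = q := rfl
  have hu' : ((qUnit⁻¹ : Kqˣ) : Kq) = q⁻¹ := rfl
  refine ⟨RingQuot.liftAlgHom Kq ⟨FreeAlgebra.lift Kq fun p => T p.1 p.2, ?_⟩, fun i j => ?_⟩
  · intro a b h
    induction h with
    | row k i j h =>
      have := hT k k j i
      simp only [if_true, lt_irrefl, if_false, h.ne', h.not_gt, zero_smul, add_zero, one_smul,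
        hu] at this
      simpa using this.symm
    | col k i j h =>
      have := hT i j k k
      simp only [if_true, lt_irrefl, if_false, h.ne, h.not_gt, zero_smul, add_zero, one_smul,
        hu] at this
      simpa using this
    | anti i k j l h h' =>
      have := hT i k l j
      simp only [h.ne, h.not_gt, h'.ne', h'.not_gt, if_false, zero_smul, add_zero,
        one_smul] at this
      simpa using this
    | diag i k j l h h' =>
      have := hT i k j l
      simp only [h.ne, h.not_gt, h'.ne, h', if_true, if_false, zero_smul, add_zero,
        one_smul, hu, hu'] at this
      simp [this]
  · simp [genT]

lemma isQuantumMatrix_one {R B ι : Type*} [CommRing R] [Ring B] [Algebra R B] [LinearOrder ι]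
    (u : Rˣ) : IsQuantumMatrix u (1 : Matrix ι ι B) := by
  intro i j k l
  simp only [Matrix.one_apply]
  split_ifs <;> simp_all

end QMat

/-! ### Classical limits of quantum matrices -/

section ClassicalLimit

/-- A matrix `M` over a commutative `A`-algebra `C` is a classical limit if it is the image of some
quantum matrix over a flat `A`-algebra. -/
def IsClassicalLimit {A : Type} [CommRing A] {ι : Type*} [LinearOrder ι] (u : Aˣ) {C : Type*}
    [CommRing C] [Algebra A C] (M : Matrix ι ι C) : Prop :=
  ∃ (B : Type) (_ : Ring B) (_ : Algebra A B) (_ : Module.Flat A B) (T : Matrix ι ι B)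
    (π : B →ₐ[A] C), IsQuantumMatrix u T ∧ T.map π = M

variable {A : Type} [CommRing A] {ι : Type} [LinearOrder ι] {u : Aˣ} {C : Type*}
    [CommRing C] [Algebra A C]

lemma IsClassicalLimit.transpose {M : Matrix ι ι C} (hM : IsClassicalLimit u M) :
    IsClassicalLimit u M.transpose := by
  obtain ⟨B, _, _, _, T, π, hT, rfl⟩ := hM
  exact ⟨B, _, _, ‹_›, T.transpose, π, hT.transpose, rfl⟩

lemma IsClassicalLimit.mul [Fintype ι] {M M' : Matrix ι ι C} (hM : IsClassicalLimit u M)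
    (hM' : IsClassicalLimit u M') : IsClassicalLimit u (M * M') := by
  obtain ⟨B, _, _, _, T, π, hT, rfl⟩ := hM
  obtain ⟨B', _, _, _, T', π', hT', rfl⟩ := hM'
  let f : B →ₐ[A] TensorProduct A B B' := Algebra.TensorProduct.includeLeft
  let f' : B' →ₐ[A] TensorProduct A B B' := Algebra.TensorProduct.includeRight
  refine ⟨TensorProduct A B B', inferInstance, inferInstance, inferInstance, T.map f * T'.map f',
    Algebra.TensorProduct.lift π π' fun _ _ => Commute.all _ _,
    (hT.map rfl f).mul (hT'.map rfl f') fun i j k l => ?_, ?_⟩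
  · simp [f, f', Commute, SemiconjBy]
  · rw [Matrix.map_mul]
    congr 1 <;> ext i j <;> simp [f, f']

lemma isClassicalLimit_diagonal [Finite ι] (d : ι → C) :
    IsClassicalLimit u (Matrix.diagonal d) := by
  refine ⟨MvPolynomial ι A, inferInstance, inferInstance, inferInstance,
    Matrix.diagonal MvPolynomial.X, MvPolynomial.aeval d, ?_, ?_⟩
  · intro i j k l
    simp only [Matrix.diagonal_apply]
    by_cases h₁ : i = k <;> by_cases h₂ : j = l <;> by_cases h₃ : j = k <;> by_cases h₄ : i = l <;>
      simp_all [mul_comm]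
  · rw [Matrix.diagonal_map (map_zero _)]
    simp

/-- The identity matrix with a lower triangular `2 × 2` quantum matrix inserted in adjacent rows and
columns is a quantum matrix. -/
lemma isQuantumMatrix_of_adjacent {B : Type*} [Ring B] [Algebra A B] {s s' : ι} (h : s ⋖ s')
    {D E Y : B} (hDE : D * E = E * D) (hDY : D * Y = (u : A) • (Y * D))
    (hYE : Y * E = (u : A) • (E * Y)) {T : Matrix ι ι B} (hs : T s s = D) (hs' : T s' s' = E)
    (hY : T s' s = Y) (h1 : ∀ i, i ≠ s → i ≠ s' → T i i = 1)
    (h0 : ∀ i j, i ≠ j → ¬(i = s' ∧ j = s) → T i j = 0) : IsQuantumMatrix u T := by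
  have hlt := h.lt
  have hne := hlt.ne
  have hcov : ∀ j, j ≠ s → j ≠ s' → (j < s' ↔ j < s) := fun j hj hj' =>
    ⟨fun hh => lt_of_le_of_ne (h.le_of_lt hh) hj, fun hh => hh.trans hlt⟩
  have hcov' : ∀ j, j ≠ s → j ≠ s' → (s' < j ↔ s < j) := fun j hj hj' =>
    ⟨fun hh => hlt.trans hh, fun hh => lt_of_le_of_ne (h.ge_of_gt hh) hj'.symm⟩
  have hdd : ∀ i j, T i i * T j j = T j j * T i i := by
    intro i j
    by_cases hi : i = s <;> by_cases hi' : i = s' <;> by_cases hj : j = s <;>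
      by_cases hj' : j = s' <;> simp_all
  have hz : ∀ a b c, a ≠ b → b ≠ c → T a b * T b c = 0 ∧ T b c * T a b = 0 := by
    intro a b c hab hbc
    by_cases hc : a = s' ∧ b = s
    · rw [h0 b c hbc fun hh => hne (hc.2.symm.trans hh.1), mul_zero, zero_mul]
      exact ⟨rfl, rfl⟩
    · rw [h0 a b hab hc, mul_zero, zero_mul]
      exact ⟨rfl, rfl⟩
  have hYD : (u : A) • (D * Y) = Y * D + (u - ↑u⁻¹ : A) • (D * Y) := by
    rw [sub_smul, hDY, smul_smul (↑u⁻¹ : A), u.inv_mul, one_smul]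
    abel
  have hEY : (u : A) • (Y * E) = E * Y + (u - ↑u⁻¹ : A) • (Y * E) := by
    rw [sub_smul, hYE, smul_smul (↑u⁻¹ : A), u.inv_mul, one_smul]
    abel
  -- The cases are those of `T i k` and `T j l` on or off the diagonal. Off-diagonal entries vanish
  -- except at `(s', s)`, and the cross term compares orders with `s` and `s'`, which agree for all
  -- other indices because `s` and `s'` are adjacent.
  intro i j k l
  by_cases hik : i = k
  · subst hik
    by_cases hjl : j = l
    · subst hjl
      by_cases hij : i = j
      · subst hij; simp
      · have : T j i * T i j = 0 := by
          by_cases hc : j = s' ∧ i = s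
          · rw [h0 i j hij fun hh => hne (hc.2.symm.trans hh.1), mul_zero]
          · rw [h0 j i (Ne.symm hij) hc, zero_mul]
        simp [hij, this, hdd i j]
    · by_cases hc : j = s' ∧ l = s
      · obtain ⟨hj, hl⟩ := hc
        rw [hj, hl]
        by_cases his : i = s
        · simp [his, hs, hY, hne, hDY, hlt.not_gt]
        by_cases his' : i = s'
        · simp [his', hs', hY, hne.symm, hYE, hlt.not_gt]
        · simp [his, his', h1 i his his', (hz s' i s (Ne.symm his') his).1]
      · have h₁ := h0 j l hjl hc
        have h₂ : T j i * T i l = 0 := by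
          by_cases hij : i = j
          · rw [hij, h₁, mul_zero]
          by_cases hil : i = l
          · rw [hil, h₁, zero_mul]
          exact (hz j i l (Ne.symm hij) hil).1
        simp [h₁, h₂]
  · by_cases hjl : j = l
    · subst hjl
      by_cases hc : i = s' ∧ k = s
      · obtain ⟨hi, hk⟩ := hc
        rw [hi, hk]
        by_cases hjs : j = s
        · simp [hjs, hs, hY, hne.symm, hYD, hlt]
        by_cases hjs' : j = s'
        · simp [hjs', hs', hY, hne, hEY, hlt]
        · simp [Ne.symm hjs, Ne.symm hjs', h1 j hjs hjs', (hz s' j s (Ne.symm hjs') hjs).2]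
      · have h₁ := h0 i k hik hc
        have h₂ : T j k * T i j = 0 := by
          by_cases hjk : j = k
          · rw [hjk, h₁, mul_zero]
          by_cases hij : i = j
          · rw [← hij, h₁, zero_mul]
          exact (hz i j k hij hjk).2
        simp [h₁, h₂]
    · by_cases hc : (i = s' ∧ k = s) ∧ j = s' ∧ l = s
      · obtain ⟨⟨hi, hk⟩, hj, hl⟩ := hc
        simp [hi, hj, hk, hl]
      have h₁ : T i k * T j l = 0 ∧ T j l * T i k = 0 := by
        rcases not_and_or.1 hc with hc | hc
        · simp [h0 i k hik hc]
        · simp [h0 j l hjl hc]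
      rw [h₁.1, h₁.2, smul_zero, smul_zero, zero_add, zero_add]
      by_cases hjk : j = k
      · subst hjk
        by_cases hil : i = l
        · rw [hil]
        · by_cases hc' : i = s' ∧ l = s
          · rw [hc'.1, hc'.2]
            simp only [hcov j (fun hh => hjl (hh.trans hc'.2.symm))
              (fun hh => hik (hc'.1.trans hh.symm))]
          · simp [h0 i l hil hc']
      · by_cases hc' : j = s' ∧ k = s
        · by_cases hil : i = l
          · subst hil
            rw [hc'.1, hc'.2]
            simp only [hcov' i (fun hh => hik (hh.trans hc'.2.symm))
              (fun hh => hjl (hc'.1.trans hh.symm))]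
          · rw [h0 i l hil fun hh => hc ⟨⟨hh.1, hc'.2⟩, hc'.1, hh.2⟩]
            simp
        · simp [h0 j k hjk hc']

omit [LinearOrder ι] in
lemma flat_of_isTorsionFree [IsDomain A] [ValuationRing A] {B : Type*} [Ring B] [Algebra A B]
    [Module.IsTorsionFree A B] : Module.Flat A B := by
  rw [Module.Flat.flat_iff_torsion_eq_bot_of_isBezout,
    ← Submodule.isTorsionFree_iff_torsion_eq_bot]
  infer_instance

variable [IsDomain A] [ValuationRing A]

open Polynomial in
/-- Elementary matrices in adjacent rows: the off-diagonal entry deforms to multiplication by the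
variable of `A[X]`, and the diagonal entries to the dilations of the affine line by `u` and its
inverse. -/
lemma isClassicalLimit_transvection_of_covBy (hu : algebraMap A C u = 1) {s s' : ι}
    (h : s ⋖ s') (c : C) : IsClassicalLimit u (Matrix.transvection s' s c) := by
  let ev : A[X] →ₐ[A] C := aeval c
  -- The operators which act on the reduction at `c` through a scalar, and the scalar `π`.
  let S : Subalgebra A (Module.End A A[X]) :=
    { carrier := {f | ∀ p, ev (f p) = ev (f 1) * ev p}
      mul_mem' := by
        intro f g hf hg p
        rw [Module.End.mul_apply, Module.End.mul_apply, hf, hg, hf (g 1), mul_assoc]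
      add_mem' := by
        intro f g hf hg p
        rw [LinearMap.add_apply, LinearMap.add_apply, map_add, map_add, hf, hg, add_mul]
      algebraMap_mem' := by
        intro a p
        change ev (a • p) = ev (a • 1) * ev p
        rw [map_smul, map_smul, map_one, smul_mul_assoc, one_mul] }
  let π : S →ₐ[A] C :=
    { toFun := fun f => ev (f.1 1)
      map_one' := by simp
      map_mul' := fun f g => by
        rw [← f.2 (g.1 1)]; rfl
      map_zero' := by simp
      map_add' := fun f g => by simp
      commutes' := fun a => by
        change ev (a • 1) = _
        rw [map_smul, map_one, Algebra.algebraMap_eq_smul_one] }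
  let dil : A → (A[X] →ₐ[A] A[X]) := fun a => aeval (Polynomial.C a * X)
  have hdil : ∀ a, algebraMap A C a = 1 → ∀ p, ev (dil a p) = ev p := by
    intro a ha p
    have : ev.comp (dil a) = ev := by
      ext; simp [ev, dil, ha]
    exact congrArg (fun f => f p) this
  have hmem : ∀ a, algebraMap A C a = 1 → (dil a).toLinearMap ∈ S := fun a ha p => by
    simp [hdil a ha]
  have hu' : algebraMap A C ↑u⁻¹ = 1 := by
    have := congrArg (algebraMap A C) u.mul_inv
    rwa [map_mul, hu, one_mul, map_one] at this
  let D : S := ⟨(dil u).toLinearMap, hmem _ hu⟩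
  let E : S := ⟨(dil ↑u⁻¹).toLinearMap, hmem _ hu'⟩
  let Y : S := ⟨LinearMap.mulLeft A X, fun p => by simp⟩
  have htf : Module.IsTorsionFree A S := inferInstance
  refine ⟨S, inferInstance, inferInstance, flat_of_isTorsionFree, Matrix.of fun i j =>
    if i = j then if i = s then D else if i = s' then E else 1
    else if i = s' ∧ j = s then Y else 0, π,
    isQuantumMatrix_of_adjacent h (D := D) (E := E) (Y := Y) ?_ ?_ ?_ ?_ ?_ ?_ ?_ ?_, ?_⟩
  · apply Subtype.ext
    have : (dil u).comp (dil ↑u⁻¹) = (dil ↑u⁻¹).comp (dil u) := by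
      ext; simp [dil, mul_left_comm]
    exact congrArg AlgHom.toLinearMap this
  · apply Subtype.ext
    refine LinearMap.ext fun p => ?_
    change dil u (X * p) = (u : A) • (X * dil u p)
    rw [map_mul]
    simp [dil, Polynomial.smul_eq_C_mul, mul_assoc]
  · apply Subtype.ext
    refine LinearMap.ext fun p => ?_
    change X * dil ↑u⁻¹ p = (u : A) • (dil ↑u⁻¹ (X * p))
    rw [map_mul]
    simp [dil, Polynomial.smul_eq_C_mul, ← mul_assoc, ← Polynomial.C_mul]
  · simp
  · simp [h.lt.ne']
  · simp [h.lt.ne']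
  · intro i hi hi'
    simp [hi, hi']
  · intro i j hij hc
    simp [hij, hc]
  · have hD : π D = 1 := by simp [π, D]
    have hE : π E = 1 := by simp [π, E]
    have hY : π Y = c := by simp [π, Y, ev]
    ext i j
    have hne := h.lt.ne
    simp only [Matrix.map_apply, Matrix.of_apply, Matrix.transvection, Matrix.add_apply,
      Matrix.one_apply, Matrix.single_apply, apply_ite π, hD, hE, hY, map_one, map_zero]
    by_cases hij : i = j
    · subst hij
      have : ¬(s' = i ∧ s = i) := fun hh => hne (hh.2.trans hh.1.symm)
      simp [this]
    · simp [hij, eq_comm]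

omit [LinearOrder ι] in
/-- Elementary matrices at non-adjacent positions are commutators of elementary matrices. -/
lemma transvection_commutator [Fintype ι] [DecidableEq ι] {i k j : ι} (hik : i ≠ k) (hkj : k ≠ j)
    (hij : i ≠ j) (c : C) :
    Matrix.transvection i k c * Matrix.transvection k j 1 * Matrix.transvection i k (-c)
      * Matrix.transvection k j (-1) = Matrix.transvection i j c := by
  have hn : ∀ (a b : ι) (x : C), Matrix.single a b (-x) = -Matrix.single a b x :=
    fun a b x => by
      ext
      rw [Matrix.neg_apply, Matrix.single_apply, Matrix.single_apply]
      split_ifs <;> simp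
  simp only [Matrix.transvection, mul_add, add_mul, mul_one, one_mul,
    Matrix.single_mul_single_same, Matrix.single_mul_single_of_ne, hik.symm,
    hkj.symm, hij.symm, ne_eq, not_false_eq_true, add_zero, mul_neg, neg_mul, hn]
  abel

lemma isClassicalLimit_transvection (hu : algebraMap A C u = 1) {N : ℕ} {i j : Fin N}
    (hij : i ≠ j) (c : C) : IsClassicalLimit u (Matrix.transvection i j c) := by
  have key : ∀ (d : ℕ) (i j : Fin N), (j : ℕ) + d + 1 = i → ∀ c : C,
      IsClassicalLimit u (Matrix.transvection i j c) := by
    intro d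
    induction d with
    | zero =>
      intro i j h c
      refine isClassicalLimit_transvection_of_covBy hu ?_ c
      rw [Fin.covBy_iff, Nat.covBy_iff_add_one_eq]
      omega
    | succ d ih =>
      intro i j h c
      obtain ⟨k, hk⟩ : ∃ k : Fin N, (k : ℕ) = j + 1 :=
        ⟨⟨j + 1, by have := i.2; omega⟩, rfl⟩
      have e₁ := ih i k (by omega)
      have e₂ : ∀ c : C, IsClassicalLimit u (Matrix.transvection k j c) := fun c => by
        refine isClassicalLimit_transvection_of_covBy hu ?_ c
        rw [Fin.covBy_iff, Nat.covBy_iff_add_one_eq]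
        omega
      rw [← transvection_commutator (k := k) (by rintro rfl; omega) (by rintro rfl; omega)
        (by rintro rfl; omega)]
      exact (((e₁ _).mul (e₂ _)).mul (e₁ _)).mul (e₂ _)
  rcases lt_or_gt_of_ne hij with h | h
  · have := (key ((j : ℕ) - i - 1) j i (by have : (i : ℕ) < j := h; omega) c).transpose
    rwa [Matrix.transvection, Matrix.transpose_add, Matrix.transpose_one,
      Matrix.transpose_single] at this
  · exact key ((i : ℕ) - j - 1) i j (by have : (j : ℕ) < i := h; omega) c

/-- Over a field, every matrix is a classical limit, because elementary and diagonal matrices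
generate all matrices under multiplication. -/
theorem isClassicalLimit {F : Type*} [Field F] [Algebra A F] (hu : algebraMap A F u = 1) {N : ℕ}
    (M : Matrix (Fin N) (Fin N) F) : IsClassicalLimit u M :=
  Matrix.diagonal_transvection_induction _ M (fun d _ => isClassicalLimit_diagonal d)
    (fun t => isClassicalLimit_transvection hu t.hij t.c) fun _ _ => IsClassicalLimit.mul

end ClassicalLimit

/-! ### Algebraic independence of the classical entries -/

section AlgebraicIndependence

variable {k σ : Type} [Field k]

/-- The field of rational functions in variables indexed by `σ`. -/
abbrev RatFunctions (k σ : Type) [Field k] : Type := FractionRing (MvPolynomial σ k)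

/-- The coordinate functions. -/
noncomputable def coord (k : Type) {σ : Type} [Field k] (s : σ) : RatFunctions k σ :=
  algebraMap (MvPolynomial σ k) _ (MvPolynomial.X s)

lemma algebraicIndependent_coord : AlgebraicIndependent k (coord k : σ → RatFunctions k σ) :=
  (MvPolynomial.algebraicIndependent_X σ k).map' (f := IsScalarTower.toAlgHom k
    (MvPolynomial σ k) (RatFunctions k σ)) (IsFractionRing.injective _ _)

lemma coord_ne_zero (s : σ) : coord k s ≠ 0 :=
  algebraicIndependent_coord.ne_zero s

/-- Elements, as many as there are coordinates, over which all coordinates are algebraic, are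
algebraically independent. Algebraicity is expressed by membership in every subfield that contains
the constants and the given elements and is closed under square roots. -/
lemma algebraicIndependent_of_forall_coord_mem [Finite σ] {x : σ → RatFunctions k σ}
    (h : ∀ L : Subfield (RatFunctions k σ), (∀ c, algebraMap k _ c ∈ L) → (∀ s, x s ∈ L) →
      (∀ y, y ^ 2 ∈ L → y ∈ L) → ∀ s, coord k s ∈ L) : AlgebraicIndependent k x := by
  let K := IntermediateField.adjoin k (Set.range x)
  let L := algebraicClosure K (RatFunctions k σ)
  have hL : ∀ s, coord k s ∈ L := by
    refine h L.toSubfield (fun c => ?_) (fun s => ?_) fun y hy => ?_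
    · exact L.algebraMap_mem (algebraMap k K c)
    · exact L.algebraMap_mem ⟨x s, IntermediateField.subset_adjoin k _ ⟨s, rfl⟩⟩
    · exact mem_algebraicClosure_iff.2 ((mem_algebraicClosure_iff.1 hy).of_pow two_pos)
  have hpoly : ∀ p : MvPolynomial σ k, algebraMap _ (RatFunctions k σ) p ∈ L := by
    intro p
    induction p using MvPolynomial.induction_on with
    | C c => exact L.algebraMap_mem (algebraMap k K c)
    | add p p' hp hp' => rw [map_add]; exact add_mem hp hp'
    | mul_X p s hp => rw [map_mul]; exact mul_mem hp (hL s)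
  have : Algebra.IsAlgebraic K (RatFunctions k σ) := by
    refine ⟨fun y => mem_algebraicClosure_iff.1 ?_⟩
    obtain ⟨a, b, -, rfl⟩ := IsFractionRing.div_surjective (A := MvPolynomial σ k) y
    exact div_mem (hpoly a) (hpoly b)
  have : Algebra.IsAlgebraic (Algebra.adjoin k (Set.range x)) (RatFunctions k σ) :=
    IntermediateField.isAlgebraic_adjoin_iff_top.1 this
  exact (Algebra.IsAlgebraic.isTranscendenceBasis_of_le_trdeg_of_finite k x
    algebraicIndependent_coord.cardinalMk_le_trdeg).1

/-- A lower triangular matrix of independent coordinates. -/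
noncomputable def lowerMatrix (k : Type) [Field k] (n : ℕ) :
    Matrix (Fin n) (Fin n) (RatFunctions k (PairsLE n)) :=
  Matrix.of fun i j => if h : j ≤ i then coord k ⟨toLex (j, i), h⟩ else 0

/-- Cholesky decomposition: the entries of `M Mᵗ` determine those of a lower triangular `M` up to
square roots. -/
lemma algebraicIndependent_lowerMatrix (k : Type) [Field k] (n : ℕ) :
    AlgebraicIndependent k fun s : PairsLE n =>
      (lowerMatrix k n * (lowerMatrix k n).transpose) (ofLex s.1).1 (ofLex s.1).2 := by
  refine algebraicIndependent_of_forall_coord_mem fun L _ hx hsq s => ?_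
  have key : ∀ j i, lowerMatrix k n i j ∈ L := by
    intro j
    induction j using WellFoundedLT.induction with
    | ind j ih =>
    have h0 : ∀ i, i < j → lowerMatrix k n i j = 0 := fun i hij => by
      simp [lowerMatrix, hij.not_ge]
    have hne : lowerMatrix k n j j ≠ 0 := by
      simp [lowerMatrix, coord_ne_zero]
    have hmul : ∀ i, j ≤ i → lowerMatrix k n j j * lowerMatrix k n i j ∈ L := by
      intro i hji
      have h := hx ⟨toLex (j, i), hji⟩
      simp only [ofLex_toLex, Matrix.mul_apply, Matrix.transpose_apply] at h
      rw [← Finset.add_sum_erase _ _ (Finset.mem_univ j)] at h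
      refine (add_mem_cancel_right (sum_mem fun r hr => ?_)).1 h
      rcases lt_or_gt_of_ne (Finset.ne_of_mem_erase hr) with hrj | hrj
      · exact mul_mem (ih r hrj j) (ih r hrj i)
      · have : lowerMatrix k n j r = 0 := by simp [lowerMatrix, hrj.not_ge]
        rw [this, zero_mul]
        exact zero_mem L
    have hjj : lowerMatrix k n j j ∈ L := hsq _ (by rw [sq]; exact hmul j le_rfl)
    intro i
    rcases lt_or_ge i j with hij | hij
    · rw [h0 i hij]
      exact zero_mem L
    · rw [← mul_div_cancel_left₀ (lowerMatrix k n i j) hne]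
      exact div_mem (hmul i hij) hjj
  have := key (ofLex s.1).1 (ofLex s.1).2
  simpa [lowerMatrix, s.2] using this

/-- A block lower triangular matrix of independent coordinates, with diagonal blocks
`diag(z, 1)`. -/
noncomputable def blockLowerMatrix (k : Type) [Field k] (n : ℕ) :
    Matrix (Fin (2 * n)) (Fin (2 * n)) (RatFunctions k (PairsLT (2 * n))) :=
  Matrix.of fun i j =>
    if j = i then if h : i < partner i then coord k ⟨toLex (i, partner i), h⟩ else 1
    else if h : partner j < i then if j = partner i then 0 else coord k ⟨toLex (partner j, i), h⟩
    else 0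

/-- The symplectic analogue of the Cholesky decomposition. -/
lemma algebraicIndependent_blockLowerMatrix (k : Type) [Field k] (n : ℕ) :
    AlgebraicIndependent k fun s : PairsLT (2 * n) =>
      ∑ r, sympCoeff (1 : RatFunctions k (PairsLT (2 * n))) r *
        (blockLowerMatrix k n (ofLex s.1).1 r
          * blockLowerMatrix k n (ofLex s.1).2 (partner r)) := by
  refine algebraicIndependent_of_forall_coord_mem fun L _ hx _ => ?_
  set M := blockLowerMatrix k n with hM
  have hself : ∀ i : Fin (2 * n), (partner i : ℕ) / 2 = i / 2 := fun i => by
    simp only [partner]; split_ifs <;> omega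
  have hblock : ∀ i r : Fin (2 * n), r ≠ i → r ≠ partner i → (r : ℕ) / 2 ≠ i / 2 := by
    intro i r h₁ h₂ h
    simp only [partner, ne_eq, Fin.ext_iff] at h₁ h₂
    split_ifs at h₂ <;> omega
  have hlt : ∀ i r : Fin (2 * n), (i : ℕ) / 2 < r / 2 → i < r ∧ i < partner r := by
    intro i r h
    have := hself r
    exact ⟨Fin.lt_def.2 (by omega), Fin.lt_def.2 (by omega)⟩
  have hzero : ∀ i r : Fin (2 * n), (i : ℕ) / 2 < r / 2 → M i r = 0 := by
    intro i r h
    obtain ⟨h₁, h₂⟩ := hlt i r h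
    simp [hM, blockLowerMatrix, h₁.ne', h₂.not_gt]
  have hpartner : ∀ i, M i (partner i) = 0 := by
    intro i
    have hne : partner i ≠ i := by
      rcases partner_cases (0 : ℤ) i with h | h
      exacts [h.1.ne', h.1.ne]
    simp [hM, blockLowerMatrix, hne]
  have hdiag : ∀ i, M i i ≠ 0 := by
    intro i
    simp only [hM, blockLowerMatrix, Matrix.of_apply, if_true]
    split_ifs
    exacts [coord_ne_zero _, one_ne_zero]
  have hc : ∀ r : Fin (2 * n), sympCoeff (1 : RatFunctions k (PairsLT (2 * n))) r ∈ L := by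
    intro r
    simp only [sympCoeff]
    split_ifs
    exacts [one_mem L, neg_mem (one_mem L)]
  have hc0 : ∀ r : Fin (2 * n), sympCoeff (1 : RatFunctions k (PairsLT (2 * n))) r ≠ 0 := by
    intro r
    simp only [sympCoeff]
    split_ifs
    exacts [one_ne_zero, neg_ne_zero.2 one_ne_zero]
  have key : ∀ (a : ℕ) (r : Fin (2 * n)), (r : ℕ) / 2 = a → ∀ j, M j r ∈ L := by
    intro a
    induction a using Nat.strong_induction_on with
    | _ a ih =>
    -- The entry `x_{ij}` isolates the product `M_{ii} M_{j,σ(i)}`.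
    have hmul : ∀ i j : Fin (2 * n), i < j → (i : ℕ) / 2 = a → M i i * M j (partner i) ∈ L := by
      intro i j hij hi
      have h := hx ⟨toLex (i, j), hij⟩
      simp only [ofLex_toLex] at h
      rw [← Finset.add_sum_erase _ _ (Finset.mem_univ i)] at h
      have h' := (add_mem_cancel_right (sum_mem fun r hr => ?_)).1 h
      · rw [← mul_div_cancel_left₀ (M i i * M j (partner i)) (hc0 i)]
        exact div_mem h' (hc i)
      · have hri := Finset.ne_of_mem_erase hr
        by_cases hrp : r = partner i
        · rw [hrp, hpartner, zero_mul, mul_zero]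
          exact zero_mem L
        · have := hblock i r hri hrp
          rcases lt_or_gt_of_ne this with h₁ | h₁
          · exact mul_mem (hc r) (mul_mem (ih _ (by omega) r rfl i)
              (ih _ (by omega) (partner r) (hself r) j))
          · rw [hzero i r h₁, zero_mul, mul_zero]
            exact zero_mem L
    have hdiag' : ∀ i : Fin (2 * n), (i : ℕ) / 2 = a → M i i ∈ L := by
      intro i hi
      by_cases h : i < partner i
      · have h₁ := hmul i (partner i) h hi
        have h₂ : M (partner i) (partner i) = 1 := by
          simp [hM, blockLowerMatrix, partner_partner, h.not_gt]
        rwa [h₂, mul_one] at h₁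
      · simp [hM, blockLowerMatrix, h, one_mem L]
    intro r hr j
    by_cases hrj : r = j
    · rw [← hrj]
      exact hdiag' r hr
    by_cases hpj : partner r < j
    · have h := hmul (partner r) j hpj ((hself r).trans hr)
      rw [partner_partner] at h
      rw [← mul_div_cancel_left₀ (M j r) (hdiag (partner r))]
      exact div_mem h (hdiag' _ ((hself r).trans hr))
    · have : M j r = 0 := by simp [hM, blockLowerMatrix, hrj, hpj]
      rw [this]
      exact zero_mem L
  rintro ⟨⟨i, j⟩, hij⟩
  change i < j at hij
  by_cases hj : j = partner i
  · have := key _ i rfl i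
    have h : i < partner i := hj ▸ hij
    subst hj
    simp only [hM, blockLowerMatrix, Matrix.of_apply, if_true, h, dif_pos] at this
    exact this
  · have := key _ (partner i) rfl j
    have h : partner i ≠ j := fun h => hj h.symm
    have h' : partner i ≠ partner j := fun h =>
      hij.ne (by rw [← partner_partner i, h, partner_partner])
    simp only [hM, blockLowerMatrix, Matrix.of_apply, h, h', if_false, partner_partner, hij,
      dif_pos] at this
    exact this

end AlgebraicIndependence

/-! ### Bases of the entry algebras -/

section Basis

/-- The valuation ring of `ℂ(q)` at `q = 1`, in which `q` is a unit congruent to `1` modulo the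
maximal ideal. -/
lemma exists_valuationRing : ∃ (A : Type) (_ : CommRing A) (_ : IsDomain A) (_ : ValuationRing A)
    (_ : Algebra A Kq) (_ : IsFractionRing A Kq) (u : Aˣ),
    algebraMap A Kq u = q ∧ (u - 1 : A) ∈ maximalIdeal A := by
  let p : Polynomial ℂ := Polynomial.X - Polynomial.C 1
  have hp : Prime p := Polynomial.prime_X_sub_C 1
  let v : IsDedekindDomain.HeightOneSpectrum (Polynomial ℂ) :=
    ⟨Ideal.span {p}, (Ideal.span_singleton_prime hp.ne_zero).2 hp, by
      simpa using hp.ne_zero⟩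
  let w := v.valuation Kq
  have hval : ∀ f : Polynomial ℂ, w (algebraMap _ Kq f) < 1 ↔ p ∣ f := fun f =>
    (v.valuation_lt_one_iff_mem (K := Kq) f).trans Ideal.mem_span_singleton
  have hle : ∀ f : Polynomial ℂ, w (algebraMap _ Kq f) ≤ 1 := fun f => v.valuation_le_one f
  have hX : algebraMap (Polynomial ℂ) Kq Polynomial.X = q := RatFunc.algebraMap_X
  have hq : w q = 1 := by
    refine le_antisymm (hX ▸ hle _) (not_lt.1 fun h => ?_)
    rw [← hX, hval, Polynomial.dvd_iff_isRoot] at h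
    simp at h
  have hq1 : w (q - 1) < 1 := by
    rw [← hX, ← map_one (algebraMap (Polynomial ℂ) Kq), ← map_sub, hval]
    simp [p]
  let A := w.valuationSubring
  let u : Aˣ := ⟨⟨q, hq.le⟩, ⟨q⁻¹, by
      show w q⁻¹ ≤ 1
      rw [map_inv₀, hq, inv_one]⟩,
    Subtype.ext (mul_inv_cancel₀ q_ne_zero), Subtype.ext (inv_mul_cancel₀ q_ne_zero)⟩
  refine ⟨A, inferInstance, inferInstance, inferInstance, inferInstance, inferInstance, u, rfl,
    (mem_maximalIdeal _).2 fun h => ?_⟩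
  obtain ⟨b, hb⟩ := h.exists_right_inv
  have h₁ : (q - 1) * (b : Kq) = 1 := congrArg Subtype.val hb
  have h₂ := congrArg w h₁
  rw [map_mul, map_one] at h₂
  have h₃ : w b ≤ 1 := b.2
  exact (mul_lt_one_of_lt_of_le hq1 h₃).ne h₂

variable {A : Type} [CommRing A] [IsDomain A] [ValuationRing A] [Algebra A Kq] {u : Aˣ}

/-- Reduces the basis property to linear independence: spanning is automatic once the generators
commute modulo the maximal ideal. -/
theorem isBasisOf_orderedMonomial {P σ ι : Type} [Finite σ] [Ring P] [Algebra Kq P] [Algebra A P]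
    [IsScalarTower A Kq P] {X : Matrix ι ι P} {x : σ → P} (hx : ∀ s, ∃ i j, x s = X i j)
    (hX : ∀ i j, X i j ∈ Submodule.span Kq (Set.range x))
    (hcomm : ∀ s t, x s * x t - x t * x s ∈
      maximalIdeal A • Submodule.span A (Set.range x) ^ 2)
    {l : List σ} (hl : l.Nodup) (hmem : ∀ s, s ∈ l)
    (hind : LinearIndependent Kq fun m : σ → ℕ => orderedMonomial l x m) :
    IsBasisOf (entryAlgebra X) fun m : σ → ℕ => orderedMonomial l x m := by
  have hentry : entryAlgebra X = Algebra.adjoin Kq (Set.range x) := by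
    refine le_antisymm (Algebra.adjoin_le ?_) (Algebra.adjoin_mono ?_)
    · rintro _ ⟨p, rfl⟩
      exact Algebra.span_le_adjoin Kq _ (hX p.1 p.2)
    · rintro _ ⟨s, rfl⟩
      obtain ⟨i, j, h⟩ := hx s
      exact ⟨(i, j), h.symm⟩
  rw [hentry]
  refine isBasisOf_of_linearIndependent hind (fun m => ?_)
    (adjoin_le_span_orderedMonomial hcomm hl hmem)
  refine list_prod_mem fun y hy => ?_
  obtain ⟨s, -, rfl⟩ := List.mem_map.1 hy
  exact pow_mem (Algebra.subset_adjoin (Set.mem_range_self s)) _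

/-- Over a field on which `u` acts as `1`, every matrix `M` is the reduction of an `A`-form `T` of
some specialization of the generic quantum matrix. -/
lemma exists_specialization [IsFractionRing A Kq] (hu : algebraMap A Kq u = q) {F : Type} [Field F]
    [Algebra A F] (hF : algebraMap A F u = 1) {N : ℕ} (M : Matrix (Fin N) (Fin N) F) :
    ∃ (B : Type) (_ : Ring B) (_ : Algebra A B) (T : Matrix (Fin N) (Fin N) B) (π : B →ₐ[A] F)
      (φ : QMat N →ₐ[Kq] TensorProduct A Kq B),
      Function.Injective (Algebra.TensorProduct.includeRight : B →ₐ[A] TensorProduct A Kq B) ∧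
      (∀ i j, φ (genT N i j) = Algebra.TensorProduct.includeRight (R := A) (A := Kq) (T i j)) ∧
      T.map π = M := by
  obtain ⟨B, _, _, _, T, π, hT, hM⟩ := isClassicalLimit (u := u) hF M
  have hT' : IsQuantumMatrix qUnit
      (T.map (Algebra.TensorProduct.includeRight : B →ₐ[A] TensorProduct A Kq B)) :=
    hT.map hu _
  -- Flatness of `B` makes it a subring of `ℂ(q) ⊗ B`.
  obtain ⟨φ, hφ⟩ := exists_algHom_of_isQuantumMatrix hT'
  exact ⟨B, _, _, T, π, φ, Algebra.TensorProduct.includeRight_injective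
    (IsFractionRing.injective A Kq), hφ, hM⟩

omit [Algebra A Kq] in
lemma algebraMap_ratFunctions_eq_one {σ : Type} (hu1 : (u - 1 : A) ∈ maximalIdeal A) :
    algebraMap A (RatFunctions (ResidueField A) σ) u = 1 := by
  rw [IsScalarTower.algebraMap_apply A (ResidueField A)]
  have : residue A (u - 1) = 0 := (residue_eq_zero_iff _).2 hu1
  rw [map_sub, map_one, sub_eq_zero] at this
  rw [ResidueField.algebraMap_eq, this, map_one]

/-- The entries of `T J Tᵗ` have linearly independent ordered monomials if the entries of
`M J Mᵗ` are algebraically independent for some commutative matrix `M`. -/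
lemma linearIndependent_orderedMonomial_matX [IsFractionRing A Kq] (hu : algebraMap A Kq u = q)
    (hu1 : (u - 1 : A) ∈ maximalIdeal A) {N : ℕ} (J : Matrix (Fin N) (Fin N) A) {σ τ : Type}
    [Finite σ] (e : σ → Fin N × Fin N)
    (M : Matrix (Fin N) (Fin N) (RatFunctions (ResidueField A) τ))
    (hM : AlgebraicIndependent (ResidueField A) fun s =>
      (M * J.map (algebraMap A (RatFunctions (ResidueField A) τ)) * M.transpose) (e s).1 (e s).2)
    {l : List σ} (hl : l.Nodup) (hmem : ∀ s, s ∈ l) :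
    LinearIndependent Kq fun m : σ → ℕ => orderedMonomial l
      (fun s => matX (genT N) (J.map (algebraMap A Kq)) (e s).1 (e s).2) m := by
  obtain ⟨B, _, _, T, π, φ, hinj, hφ, rfl⟩ :=
    exists_specialization hu (algebraMap_ratFunctions_eq_one hu1) M
  refine linearIndependent_orderedMonomial φ hinj π
    (y := fun s => (T * J.map (algebraMap A B) * T.transpose) (e s).1 (e s).2) (fun s => ?_) ?_
    hl hmem
  · have hJ : ∀ a : A, algebraMap Kq (TensorProduct A Kq B) (algebraMap A Kq a)
        = algebraMap A (TensorProduct A Kq B) a := fun a =>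
      (IsScalarTower.algebraMap_apply A Kq _ a).symm
    simp only [matX, Matrix.mul_apply, Matrix.map_apply, Matrix.transpose_apply, map_sum, map_mul,
      hφ, AlgHom.commutes, hJ]
  · convert hM using 2 with s
    simp only [Matrix.mul_apply, Matrix.map_apply, Matrix.transpose_apply, map_sum, map_mul,
      AlgHom.commutes]

omit [IsDomain A] [ValuationRing A] in
/-- The relations over `ℂ(q)` hold over `A` already, since their coefficients lie in `A`. -/
lemma IsQuantumMatrix.restrictScalars {P ι : Type} [Ring P] [Algebra Kq P] [Algebra A P]
    [IsScalarTower A Kq P] [LinearOrder ι] (hu : algebraMap A Kq u = q) {T : Matrix ι ι P}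
    (hT : IsQuantumMatrix qUnit T) : IsQuantumMatrix u T := by
  have h₁ : algebraMap A Kq u = (qUnit : Kq) := hu
  have h₂ : algebraMap A Kq ↑u⁻¹ = ((qUnit⁻¹ : Kqˣ) : Kq) := by
    rw [show qUnit = Units.map (algebraMap A Kq).toMonoidHom u from Units.ext h₁.symm, ← map_inv]
    rfl
  intro i j k l
  have key : ∀ (a : A) (p : P), a • p = algebraMap A Kq a • p := fun a p =>
    (algebraMap_smul Kq a p).symm
  have := hT i j k l
  rw [← h₁, ← h₂] at this
  simp only [key, apply_ite (algebraMap A Kq), map_sub, map_zero, map_one]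
  exact this

/-- Bases for the algebra generated by the entries of `T J Tᵗ`, where `T` is a quantum matrix and
`J` solves the reflection equation. -/
theorem isBasisOf_of_reflection (hu : algebraMap A Kq u = q) (hu1 : (u - 1 : A) ∈ maximalIdeal A)
    {P ι σ : Type} [Ring P] [Algebra Kq P] [LinearOrder ι] [Fintype ι] [Finite σ]
    {T : Matrix ι ι P} (hT : IsQuantumMatrix qUnit T) {J : Matrix ι ι A}
    (hJ : IsReflectionSolution u J) (e : σ → ι × ι) {X : Matrix ι ι P}
    (hXJ : X = matX T (J.map (algebraMap A Kq)))
    (hX : ∀ i j, X i j = 0 ∨ ∃ (a : A) (s : σ), X i j = algebraMap A Kq a • X (e s).1 (e s).2)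
    {l : List σ} (hl : l.Nodup) (hmem : ∀ s, s ∈ l)
    (hind : LinearIndependent Kq fun m : σ → ℕ =>
      orderedMonomial l (fun s => X (e s).1 (e s).2) m) :
    IsBasisOf (entryAlgebra X)
      fun m : σ → ℕ => orderedMonomial l (fun s => X (e s).1 (e s).2) m := by
  let _ : Algebra A P := Algebra.compHom P (algebraMap A Kq)
  have _ : IsScalarTower A Kq P := IsScalarTower.of_algebraMap_eq fun _ => rfl
  have hmap : (J.map (algebraMap A Kq)).map (algebraMap Kq P) = J.map (algebraMap A P) := by
    ext i j
    exact (IsScalarTower.algebraMap_apply A Kq P (J i j)).symm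
  have href := (hT.restrictScalars hu).reflection hJ (X := X) (by rw [hXJ, matX, hmap])
  have hV : ∀ i j, X i j ∈ Submodule.span A (Set.range fun s => X (e s).1 (e s).2) := by
    intro i j
    rcases hX i j with h | ⟨a, s, h⟩
    · rw [h]
      exact zero_mem _
    · rw [h, algebraMap_smul]
      exact Submodule.smul_mem _ _ (Submodule.subset_span ⟨s, rfl⟩)
  refine isBasisOf_orderedMonomial (A := A) (X := X) (fun s => ⟨(e s).1, (e s).2, rfl⟩)
    (fun i j => Submodule.span_le_restrictScalars A Kq _ (hV i j)) (fun s t => ?_) hl hmem hind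
  exact commutator_mem_of_reflection hu1 href hV _ _ _ _

/-- Bases for the algebra generated by a quantum matrix. -/
theorem isBasisOf_of_isQuantumMatrix (hu : algebraMap A Kq u = q)
    (hu1 : (u - 1 : A) ∈ maximalIdeal A) {P ι κ σ : Type} [Ring P] [Algebra Kq P] [LinearOrder ι]
    [Finite σ] {Y : Matrix ι ι P} (hY : IsQuantumMatrix qUnit Y) {e : σ → ι × ι}
    (he : Function.Surjective e) {X : Matrix κ κ P} {x : σ → P}
    (hxY : ∀ s, x s = Y (e s).1 (e s).2) (hx : ∀ s, ∃ i j, x s = X i j)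
    (hX : ∀ i j, X i j ∈ Submodule.span Kq (Set.range x))
    {l : List σ} (hl : l.Nodup) (hmem : ∀ s, s ∈ l)
    (hind : LinearIndependent Kq fun m : σ → ℕ => orderedMonomial l x m) :
    IsBasisOf (entryAlgebra X) fun m : σ → ℕ => orderedMonomial l x m := by
  let _ : Algebra A P := Algebra.compHom P (algebraMap A Kq)
  have _ : IsScalarTower A Kq P := IsScalarTower.of_algebraMap_eq fun _ => rfl
  refine isBasisOf_orderedMonomial (A := A) hx hX (fun s t => ?_) hl hmem hind
  rw [hxY, hxY]
  refine (hY.restrictScalars hu).commutator_mem hu1 (fun i j => ?_) _ _ _ _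
  obtain ⟨s, hs⟩ := he (i, j)
  exact Submodule.subset_span ⟨s, by rw [hxY, hs]⟩

theorem isBasisOf_xAI [IsFractionRing A Kq] (hu : algebraMap A Kq u = q)
    (hu1 : (u - 1 : A) ∈ maximalIdeal A) (n : ℕ) {l : List (PairsLE n)} (hl : l.Nodup)
    (hmem : ∀ s, s ∈ l) :
    IsBasisOf (entryAlgebra (xAI n)) fun m : PairsLE n → ℕ =>
      orderedMonomial l (fun s => xAI n (ofLex s.1).1 (ofLex s.1).2) m := by
  have hJ : xAI n = matX (genT n) ((1 : Matrix (Fin n) (Fin n) A).map (algebraMap A Kq)) := by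
    rw [Matrix.map_one _ (map_zero _) (map_one _), xAI]
  refine isBasisOf_of_reflection hu hu1 (genT_isQuantumMatrix n) (isReflectionSolution_one u)
    (fun s : PairsLE n => ((ofLex s.1).1, (ofLex s.1).2)) hJ (fun i j => Or.inr ?_) hl hmem ?_
  · rcases le_or_gt i j with h | h
    · exact ⟨1, ⟨toLex (i, j), h⟩, by simp⟩
    · refine ⟨↑u⁻¹, ⟨toLex (j, i), h.le⟩, ?_⟩
      have hs := (genT_isQuantumMatrix n).symm_entry h
      have hm : xAI n = genT n * (genT n).transpose := by
        rw [xAI, matX, Matrix.map_one _ (map_zero _) (map_one _), mul_one]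
      have hinv : algebraMap A Kq ↑u⁻¹ * (qUnit : Kq) = 1 := by
        rw [show (qUnit : Kq) = algebraMap A Kq u from hu.symm, ← map_mul, u.inv_mul, map_one]
      simp only [ofLex_toLex]
      rw [hm, hs, smul_smul, hinv, one_smul]
  · rw [hJ]
    refine linearIndependent_orderedMonomial_matX hu hu1 1 _ (lowerMatrix (ResidueField A) n) ?_
      hl hmem
    simpa using algebraicIndependent_lowerMatrix (ResidueField A) n

lemma map_sympMatrix {R S : Type*} [CommRing R] [CommRing S] (f : R →+* S) (a : R) (n : ℕ) :
    (sympMatrix a n).map f = sympMatrix (f a) n := by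
  ext i j
  simp only [sympMatrix, sympCoeff, Matrix.map_apply, Matrix.of_apply]
  split_ifs <;> simp

theorem isBasisOf_xAII [IsFractionRing A Kq] (hu : algebraMap A Kq u = q)
    (hu1 : (u - 1 : A) ∈ maximalIdeal A) (n : ℕ) {l : List (PairsLT (2 * n))} (hl : l.Nodup)
    (hmem : ∀ s, s ∈ l) :
    IsBasisOf (entryAlgebra (xAII n)) fun m : PairsLT (2 * n) → ℕ =>
      orderedMonomial l (fun s => xAII n (ofLex s.1).1 (ofLex s.1).2) m := by
  have hJ : xAII n = matX (genT (2 * n)) ((sympMatrix (u : A) n).map (algebraMap A Kq)) := by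
    rw [xAII, jAII_eq, map_sympMatrix, hu]
  refine isBasisOf_of_reflection hu hu1 (genT_isQuantumMatrix (2 * n))
    (isReflectionSolution_sympMatrix u n)
    (fun s : PairsLT (2 * n) => ((ofLex s.1).1, (ofLex s.1).2)) hJ (fun i j => ?_) hl hmem ?_
  · rw [xAII, jAII_eq, matX]
    rcases lt_trichotomy i j with h | rfl | h
    · exact Or.inr ⟨1, ⟨toLex (i, j), h⟩, by simp⟩
    · exact Or.inl ((genT_isQuantumMatrix (2 * n)).symp_entry_self i)
    · refine Or.inr ⟨-u, ⟨toLex (j, i), h⟩, ?_⟩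
      rw [map_neg, hu]
      exact (genT_isQuantumMatrix (2 * n)).symp_entry_swap h
  · rw [hJ]
    refine linearIndependent_orderedMonomial_matX hu hu1 (sympMatrix (u : A) n) _
      (blockLowerMatrix (ResidueField A) n) ?_ hl hmem
    rw [map_sympMatrix, algebraMap_ratFunctions_eq_one hu1]
    have h : ∀ i j, _ = _ := mul_sympMatrix_mul_apply
      (1 : RatFunctions (ResidueField A) (PairsLT (2 * n))) (blockLowerMatrix (ResidueField A) n)
    simp only [Algebra.algebraMap_self, RingHom.coe_id, Matrix.map_id, smul_eq_mul] at h
    simp only [h]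
    exact algebraicIndependent_blockLowerMatrix (ResidueField A) n


/-- If `S` and `T` commute entrywise, the product `X = D J Dᵗ` for `D = diag(S, T)` and `J`
the block swap has blocks `S Tᵗ` and its transpose off the diagonal. -/
lemma matX_fromBlocks {P ι : Type} [Ring P] [Algebra Kq P] [Fintype ι] [DecidableEq ι]
    {S T : Matrix ι ι P} (h : ∀ i j k l, Commute (S i j) (T k l)) :
    matX (Matrix.fromBlocks S 0 0 T) (Matrix.fromBlocks 0 1 1 0)
      = Matrix.fromBlocks 0 (S * T.transpose) (S * T.transpose).transpose 0 := by
  have hT : T * S.transpose = (S * T.transpose).transpose := by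
    ext i j
    simp only [Matrix.mul_apply, Matrix.transpose_apply]
    exact Finset.sum_congr rfl fun r _ => (h _ _ _ _).symm
  rw [matX, Matrix.fromBlocks_map, Matrix.map_one _ (map_zero _) (map_one _),
    Matrix.map_zero _ (map_zero _), Matrix.fromBlocks_transpose, Matrix.fromBlocks_multiply,
    Matrix.fromBlocks_multiply, ← hT]
  simp

/-- The off-diagonal block of `X` in the diagonal type. -/
noncomputable def diagBlock (n : ℕ) : Matrix (Fin n) (Fin n) (PDiag n) :=
  (genT n).map (Algebra.TensorProduct.includeLeft : QMat n →ₐ[Kq] PDiag n) *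
    ((genT n).map (Algebra.TensorProduct.includeRight : QMat n →ₐ[Kq] PDiag n)).transpose

lemma commute_includeLeft_includeRight {P Q : Type} [Ring P] [Ring Q] [Algebra Kq P] [Algebra Kq Q]
    (a : P) (b : Q) :
    Commute ((Algebra.TensorProduct.includeLeft : P →ₐ[Kq] TensorProduct Kq P Q) a)
      ((Algebra.TensorProduct.includeRight : Q →ₐ[Kq] TensorProduct Kq P Q) b) := by
  simp [Commute, SemiconjBy]

lemma xDiag_eq (n : ℕ) :
    xDiag n = Matrix.fromBlocks 0 (diagBlock n) (diagBlock n).transpose 0 :=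
  matX_fromBlocks fun _ _ _ _ => commute_includeLeft_includeRight _ _

lemma diagBlock_isQuantumMatrix (n : ℕ) : IsQuantumMatrix qUnit (diagBlock n) :=
  ((genT_isQuantumMatrix n).map rfl _).mul ((genT_isQuantumMatrix n).map rfl _).transpose
    fun _ _ _ _ => commute_includeLeft_includeRight _ _

/-- The counit of the second tensor factor maps the off-diagonal block of `X` to the matrix of
generators. -/
lemma exists_algHom_diagBlock (n : ℕ) :
    ∃ ψ : PDiag n →ₐ[Kq] QMat n, ∀ i j, ψ (diagBlock n i j) = genT n i j := by
  obtain ⟨ε, hε⟩ := exists_algHom_of_isQuantumMatrix (N := n) (E := Kq) (isQuantumMatrix_one qUnit)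
  let ψ : PDiag n →ₐ[Kq] QMat n :=
    Algebra.TensorProduct.lift (AlgHom.id Kq (QMat n)) ((Algebra.ofId Kq (QMat n)).comp ε)
      fun a b => (Algebra.commutes (ε b) a).symm
  have h₁ : ∀ a, ψ ((Algebra.TensorProduct.includeLeft : QMat n →ₐ[Kq] PDiag n) a) = a :=
    fun a => (Algebra.TensorProduct.lift_tmul _ _ _ a 1).trans (by
      rw [map_one, mul_one, AlgHom.id_apply])
  have h₂ : ∀ b, ψ ((Algebra.TensorProduct.includeRight : QMat n →ₐ[Kq] PDiag n) b)
      = algebraMap Kq (QMat n) (ε b) :=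
    fun b => (Algebra.TensorProduct.lift_tmul _ _ _ 1 b).trans (by
      rw [map_one, one_mul, AlgHom.comp_apply, Algebra.ofId_apply])
  refine ⟨ψ, fun i j => ?_⟩
  rw [diagBlock, Matrix.mul_apply, map_sum]
  simp only [Matrix.map_apply, Matrix.transpose_apply, map_mul, h₁, h₂, hε, Matrix.one_apply,
    apply_ite (algebraMap Kq (QMat n)), map_one, map_zero, mul_ite, mul_one, mul_zero,
    Finset.sum_ite_eq, Finset.mem_univ, if_true]

theorem isBasisOf_xDiag [IsFractionRing A Kq] (hu : algebraMap A Kq u = q)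
    (hu1 : (u - 1 : A) ∈ maximalIdeal A) (n : ℕ) {l : List (Fin n ×ₗ Fin n)} (hl : l.Nodup)
    (hmem : ∀ s, s ∈ l) :
    IsBasisOf (entryAlgebra (xDiag n)) fun m : Fin n ×ₗ Fin n → ℕ =>
      orderedMonomial l (fun s => xDiag n (Sum.inl (ofLex s).1) (Sum.inr (ofLex s).2)) m := by
  have hxY : ∀ i j, xDiag n (Sum.inl i) (Sum.inr j) = diagBlock n i j := fun i j => by
    rw [xDiag_eq, Matrix.fromBlocks_apply₁₂]
  have hV : ∀ i j, diagBlock n i j ∈ Submodule.span Kq (Set.range fun s : Fin n ×ₗ Fin n =>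
      xDiag n (Sum.inl (ofLex s).1) (Sum.inr (ofLex s).2)) :=
    fun i j => Submodule.subset_span ⟨toLex (i, j), hxY i j⟩
  refine isBasisOf_of_isQuantumMatrix hu hu1 (diagBlock_isQuantumMatrix n) (e := ofLex)
    ofLex.surjective (fun s => hxY _ _) (fun s => ⟨_, _, rfl⟩) ?_ hl hmem ?_
  · rintro (i | i) (j | j)
    · rw [xDiag_eq, Matrix.fromBlocks_apply₁₁]
      exact zero_mem _
    · rw [hxY]
      exact hV i j
    · rw [xDiag_eq, Matrix.fromBlocks_apply₂₁, ← xDiag_eq]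
      exact hV j i
    · rw [xDiag_eq, Matrix.fromBlocks_apply₂₂]
      exact zero_mem _
  obtain ⟨ψ, hψ⟩ := exists_algHom_diagBlock n
  obtain ⟨B, _, _, T, π, φ, hinj, hφ, hπ⟩ := exists_specialization hu
    (algebraMap_ratFunctions_eq_one (σ := Fin n ×ₗ Fin n) hu1)
    (Matrix.of fun i j => coord (ResidueField A) (toLex (i, j)))
  refine linearIndependent_orderedMonomial (φ.comp ψ) hinj π
    (y := fun s => T (ofLex s).1 (ofLex s).2) (fun s => ?_) ?_ hl hmem
  · rw [hxY, AlgHom.comp_apply, hψ, hφ]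
  · have h : ∀ s : Fin n ×ₗ Fin n, π (T (ofLex s).1 (ofLex s).2) = coord (ResidueField A) s :=
      fun s => congrFun (congrFun hπ _) _
    simp only [h]
    exact algebraicIndependent_coord

/-- Monomials in increasing and in decreasing order are ordered monomials for two enumerations of
the index set. -/
lemma isBasisOf_monomialAsc_monomialDesc {P σ : Type} [Fintype σ] [LinearOrder σ] [Ring P]
    [Algebra Kq P] {S : Subalgebra Kq P} {x : σ → P}
    (h : ∀ l : List σ, l.Nodup → (∀ s, s ∈ l) → IsBasisOf S fun m => orderedMonomial l x m) :
    IsBasisOf S (fun m => monomialAsc x m) ∧ IsBasisOf S (fun m => monomialDesc x m) :=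
  ⟨h _ (Finset.sort_nodup _ _) fun s => (Finset.mem_sort _).2 (Finset.mem_univ s),
    h _ (List.nodup_reverse.2 (Finset.sort_nodup _ _)) fun s =>
      List.mem_reverse.2 ((Finset.mem_sort _).2 (Finset.mem_univ s))⟩

end Basis

end QuantumHomogeneous

theorem mainTheorem4 (n : ℕ) :
    -- Type AI: monomials in the `x_{ij}`, `i ≤ j`
    (QuantumHomogeneous.IsBasisOf
        (QuantumHomogeneous.entryAlgebra (QuantumHomogeneous.xAI n))
        (fun m : QuantumHomogeneous.PairsLE n → ℕ =>
          QuantumHomogeneous.monomialAsc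
            (fun s => QuantumHomogeneous.xAI n (ofLex s.1).1 (ofLex s.1).2) m) ∧
      QuantumHomogeneous.IsBasisOf
        (QuantumHomogeneous.entryAlgebra (QuantumHomogeneous.xAI n))
        (fun m : QuantumHomogeneous.PairsLE n → ℕ =>
          QuantumHomogeneous.monomialDesc
            (fun s => QuantumHomogeneous.xAI n (ofLex s.1).1 (ofLex s.1).2) m)) ∧
    -- Type AII: monomials in the `x_{ij}`, `i < j`
    (QuantumHomogeneous.IsBasisOf
        (QuantumHomogeneous.entryAlgebra (QuantumHomogeneous.xAII n))
        (fun m : QuantumHomogeneous.PairsLT (2 * n) → ℕ =>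
          QuantumHomogeneous.monomialAsc
            (fun s => QuantumHomogeneous.xAII n (ofLex s.1).1 (ofLex s.1).2) m) ∧
      QuantumHomogeneous.IsBasisOf
        (QuantumHomogeneous.entryAlgebra (QuantumHomogeneous.xAII n))
        (fun m : QuantumHomogeneous.PairsLT (2 * n) → ℕ =>
          QuantumHomogeneous.monomialDesc
            (fun s => QuantumHomogeneous.xAII n (ofLex s.1).1 (ofLex s.1).2) m)) ∧
    -- Diagonal type: monomials in the `x_{i,n+j}`, `1 ≤ i, j ≤ n`
    (QuantumHomogeneous.IsBasisOf
        (QuantumHomogeneous.entryAlgebra (QuantumHomogeneous.xDiag n))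
        (fun m : Fin n ×ₗ Fin n → ℕ =>
          QuantumHomogeneous.monomialAsc
            (fun s => QuantumHomogeneous.xDiag n (Sum.inl (ofLex s).1) (Sum.inr (ofLex s).2)) m) ∧
      QuantumHomogeneous.IsBasisOf
        (QuantumHomogeneous.entryAlgebra (QuantumHomogeneous.xDiag n))
        (fun m : Fin n ×ₗ Fin n → ℕ =>
          QuantumHomogeneous.monomialDesc
            (fun s => QuantumHomogeneous.xDiag n (Sum.inl (ofLex s).1) (Sum.inr (ofLex s).2)) m)) := by
  obtain ⟨A, _, _, _, _, _, u, hu, hu1⟩ := QuantumHomogeneous.exists_valuationRing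
  exact ⟨QuantumHomogeneous.isBasisOf_monomialAsc_monomialDesc fun _ hl hmem =>
      QuantumHomogeneous.isBasisOf_xAI hu hu1 n hl hmem,
    QuantumHomogeneous.isBasisOf_monomialAsc_monomialDesc fun _ hl hmem =>
      QuantumHomogeneous.isBasisOf_xAII hu hu1 n hl hmem,
    QuantumHomogeneous.isBasisOf_monomialAsc_monomialDesc fun _ hl hmem =>
      QuantumHomogeneous.isBasisOf_xDiag hu hu1 n hl hmem⟩
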